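/- Let $G$ be a connected undirected weighted graph with finite or countable vertex set $V$ and symmetric weight $w\ge 0$, $w(v,v)=0$, whose edges are the pairs $(u,v)$ with $w(u,v)\neq 0$ and whose degrees $w(v)=\sum_{u}w(u,v)$ are uniformly bounded. Let $L$ be the Laplacian $(Lf)(v)=\sum_u w(v,u)(f(v)-f(u))$, a bounded self-adjoint non-negative operator on the space $\ell^2(V)$ of complex functions, with $\langle f,g\rangle=\sum_v f(v)\overline{g(v)}$. For $\omega>0$ let $PW_\omega(L)$ be the image of the spectral projection $\mathbf 1_{[0,\omega]}(L)$, with orthogonal projection $\mathcal P_\omega$. Let $\{S_j\}_{j\in J}$ be a cover of $V$ by finite connected sets with more than one vertex, such that no edge of $G$ has both its ends in $S_j$ and both its ends in $S_k$ for two different indices $j\ne k$. Let $\lambda_{1,j}$ be the smallest nonzero eigenvalue of the Laplacian of the induced weighted graph on $S_j$. Let $\psi_j\in\ell^2(V)$ be supported in $S_j$, put $\Psi_j(f)=\langle f,\psi_j\rangle$, let $\chi_j$ be the characteristic function of $S_j$, assume $\Psi_j(\chi_j)\ne0$, and put $\theta_j=|S_j|\,\|\psi_j\|^2/|\Psi_j(\chi_j)|^2$.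 Assume $\Theta=\sup_j\theta_j<\infty$ and $\Lambda=\inf_j\lambda_{1,j}>0$, and that there are constants $c,C$ with $|S_j|^2/|\Psi_j(\chi_j)|^2\le c$ and $\|\psi_j\|^2\le C$ for all $j$. Let $\epsilon>0$ and $0<\omega<\Lambda/((1+\epsilon)\Theta)$, and put $\gamma=(1+\epsilon)\frac{\Theta}{\Lambda}\omega<1$ and $\xi_j=\mathcal P_\omega\psi_j$, so that $\langle f,\xi_j\rangle=\langle f,\psi_j\rangle$ for $f\in PW_\omega(L)$. Then the following hold. (a) There is a number $N$ such that every vertex lies in at most $N$ of the sets $S_j$, and for every such $N$ the family $\{\xi_j\}$ is a frame of $PW_\omega(L)$ with lower bound $\frac{(1-\gamma)\epsilon}{(1+\epsilon)c}$ and upper bound $CN$ (the former not exceeding the latter), that is, $$\frac{(1-\gamma)\epsilon}{(1+\epsilon)c}\|f\|^2\le\sum_{j}|\langle f,\psi_j\rangle|^2\le CN\|f\|^2,\qquad f\in PW_\omega(L).$$ (b) Every $f\in PW_\omega(L)$ is uniquely determined by the numbers $\{\langle f,\psi_j\rangle\}_{j\in J}$: if $f,g\in PW_\omega(L)$ have the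 same samples, then $f=g$. (c) There is a family $\{\Omega_j\}_{j\in J}$ in $PW_\omega(L)$ with $f=\sum_j\langle f,\psi_j\rangle\Omega_j$ for all $f\in PW_\omega(L)$ such that, whenever $A,B>0$ are frame bounds of $\{\xi_j\}$ in $PW_\omega(L)$, $\{\Omega_j\}$ is a frame with bounds $B^{-1},A^{-1}$, and the reconstruction is stable: for every perturbation $e\in\ell^2(J)$ of the samples the series $\sum_j(\langle f,\psi_j\rangle+e_j)\Omega_j$ converges and differs from $f$ in norm by at most $A^{-1/2}\|e\|_{\ell^2(J)}$. (d) Let $0<A\le B$ be frame bounds of $\{\xi_j\}$ in $PW_\omega(L)$, let $0<\rho<2/B$, and put $\eta=\max\{|1-\rho A|,|1-\rho B|\}$. Then $\eta<1$. Given data $s=(s_j)_{j\in J}$, define $f_0=0$ and $f_{n}=f_{n-1}+\rho\sum_j(s_j-\langle f_{n-1},\psi_j\rangle)\xi_j$; for $s_j=\langle f,\psi_j\rangle$ this is the frame algorithm $f_n=f_{n-1}+\rho\,\Phi(f-f_{n-1})$ with the frame operator $\Phi g=\sum_j\langle g,\xi_j\rangle\xi_j$. The series $\sum_j e_j\xi_j$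 converges for every $e\in\ell^2(J)$. For every $f\in PW_\omega(L)$ and the exact data $s_j=\langle f,\psi_j\rangle$ one has $\|f-f_n\|\le\eta^n\|f\|$ for all $n$, and hence $f_n\to f$; and for perturbed data $s_j=\langle f,\psi_j\rangle+e_j$ with $e\in\ell^2(J)$ one has $\|f-f_n\|\le\eta^n\|f\|+2A^{-1/2}\|e\|_{\ell^2(J)}$ for all $n$. -/

import Mathlib

open scoped InnerProductSpace Topology

noncomputable section

/-! ## Weighted graphs and their Laplacians -/

/-- An undirected weighted graph with vertex set `V`: a symmetric weight `w ≥ 0` vanishing on the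
diagonal, with `w(v) = ∑ u, w v u < ∞` for every vertex.  The edges are the pairs with nonzero
weight. -/
structure WeightedGraph (V : Type*) where
  w : V → V → ℝ
  nonneg : ∀ u v, 0 ≤ w u v
  symm : ∀ u v, w u v = w v u
  loopless : ∀ v, w v v = 0
  summable : ∀ v, Summable (w v)

/-- The Hilbert space `ℓ²(V)` of square summable complex functions on `V`. In Mathlib's convention
the inner product `⟪g, f⟫_ℂ` is `∑ v, f v * conj (g v)`. -/
abbrev EllTwo (V : Type*) : Type _ := lp (fun _ : V => ℂ) 2

namespace WeightedGraph

variable {V : Type*} (G : WeightedGraph V)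

/-- The degree `w(v) = ∑ u, w(v, u)`. -/
def degree (v : V) : ℝ := ∑' u, G.w v u

/-- The degrees are uniformly bounded. -/
def BddDegree : Prop := ∃ D : ℝ, ∀ v, G.degree v ≤ D

/-- The underlying simple graph. -/
def graph : SimpleGraph V where
  Adj u v := G.w u v ≠ 0
  symm := ⟨fun u v h => by rwa [G.symm v u]⟩
  loopless := ⟨fun v h => h (G.loopless v)⟩

/-- The induced weighted graph on a finite set of vertices. -/
def induce (S : Finset V) : WeightedGraph S where
  w u v := G.w u v
  nonneg u v := G.nonneg u v
  symm u v := G.symm u v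
  loopless v := G.loopless v
  summable _ := Summable.of_finite

theorem degree_nonneg (v : V) : 0 ≤ G.degree v := tsum_nonneg (G.nonneg v)

theorem bddDegree_of_finite [Finite V] : G.BddDegree := by
  obtain ⟨D, hD⟩ := (Set.finite_range G.degree).bddAbove
  exact ⟨D, fun v => hD ⟨v, rfl⟩⟩

/-- The pointwise formula `(L f)(v) = ∑ u, w(v, u) (f v - f u)`. -/
def lapFun (f : V → ℂ) (v : V) : ℂ := ∑' u, (G.w v u : ℂ) * (f v - f u)

theorem summable_weight_mul_sq (f : EllTwo V) (v : V) :
    Summable fun u => G.w v u * ‖f u‖ ^ 2 := by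
  refine Summable.of_nonneg_of_le (fun u => mul_nonneg (G.nonneg v u) (by positivity))
    (fun u => ?_) ((G.summable v).mul_right (‖f‖ ^ 2))
  have := lp.norm_apply_le_norm (p := 2) (by norm_num) f u
  have h0 := G.nonneg v u
  gcongr

theorem summable_weight_mul_norm_sub (f : EllTwo V) (v : V) :
    Summable fun u => G.w v u * ‖f v - f u‖ := by
  refine Summable.of_nonneg_of_le (fun u => mul_nonneg (G.nonneg v u) (norm_nonneg _))
    (fun u => ?_) ((G.summable v).mul_right (‖f‖ + ‖f‖))
  have h1 := lp.norm_apply_le_norm (p := 2) (by norm_num) f u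
  have h2 := lp.norm_apply_le_norm (p := 2) (by norm_num) f v
  have h0 := G.nonneg v u
  have h3 := norm_sub_le (f v) (f u)
  gcongr
  linarith

theorem summable_lapFun (f : EllTwo V) (v : V) :
    Summable fun u => (G.w v u : ℂ) * (f v - f u) := by
  refine Summable.of_norm ?_
  simpa [abs_of_nonneg (G.nonneg v _)] using G.summable_weight_mul_norm_sub f v

theorem norm_lapFun_sq_le {D : ℝ} (hD : ∀ v, G.degree v ≤ D) (f : EllTwo V) (v : V) :
    ‖G.lapFun f v‖ ^ 2 ≤ 2 * D ^ 2 * ‖f v‖ ^ 2 + 2 * D * ∑' u, G.w v u * ‖f u‖ ^ 2 := by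
  have hD0 : 0 ≤ D := (G.degree_nonneg v).trans (hD v)
  have h1 : ‖G.lapFun f v‖ ≤ ∑' u, G.w v u * ‖f v - f u‖ := by
    have hs := G.summable_weight_mul_norm_sub f v
    have : ∀ u, ‖(G.w v u : ℂ) * (f v - f u)‖ = G.w v u * ‖f v - f u‖ := fun u => by
      simp [abs_of_nonneg (G.nonneg v u)]
    unfold lapFun
    refine (norm_tsum_le_tsum_norm ?_).trans_eq (tsum_congr this)
    rw [summable_congr this]
    exact hs
  have h2 : (∑' u, G.w v u * ‖f v - f u‖) ^ 2 ≤
      2 * D ^ 2 * ‖f v‖ ^ 2 + 2 * D * ∑' u, G.w v u * ‖f u‖ ^ 2 := by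
    have ht := (G.summable_weight_mul_norm_sub f v).hasSum.pow 2
    refine le_of_tendsto' ht fun s => ?_
    have hcs : (∑ u ∈ s, G.w v u * ‖f v - f u‖) ^ 2 ≤
        (∑ u ∈ s, G.w v u) * ∑ u ∈ s, G.w v u * ‖f v - f u‖ ^ 2 := by
      refine Finset.sum_sq_le_sum_mul_sum_of_sq_le_mul s (fun u _ => G.nonneg v u)
        (fun u _ => mul_nonneg (G.nonneg v u) (by positivity)) (fun u _ => by apply le_of_eq; ring)
    have hw : ∑ u ∈ s, G.w v u ≤ D :=
      ((G.summable v).sum_le_tsum s (fun u _ => G.nonneg v u)).trans (hD v)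
    have hq : ∑ u ∈ s, G.w v u * ‖f u‖ ^ 2 ≤ ∑' u, G.w v u * ‖f u‖ ^ 2 :=
      (G.summable_weight_mul_sq f v).sum_le_tsum s
        (fun u _ => mul_nonneg (G.nonneg v u) (by positivity))
    have hb : ∑ u ∈ s, G.w v u * ‖f v - f u‖ ^ 2 ≤
        2 * D * ‖f v‖ ^ 2 + 2 * ∑' u, G.w v u * ‖f u‖ ^ 2 := by
      have : ∑ u ∈ s, G.w v u * ‖f v - f u‖ ^ 2 ≤
          2 * (∑ u ∈ s, G.w v u) * ‖f v‖ ^ 2 + 2 * ∑ u ∈ s, G.w v u * ‖f u‖ ^ 2 := by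
        rw [Finset.mul_sum, Finset.mul_sum, Finset.sum_mul, ← Finset.sum_add_distrib]
        refine Finset.sum_le_sum fun u _ => ?_
        have h3 : ‖f v - f u‖ ^ 2 ≤ 2 * ‖f v‖ ^ 2 + 2 * ‖f u‖ ^ 2 := by
          have := norm_sub_le (f v) (f u)
          nlinarith [sq_nonneg (‖f v‖ - ‖f u‖), norm_nonneg (f v - f u)]
        nlinarith [mul_le_mul_of_nonneg_left h3 (G.nonneg v u)]
      have h4 : (∑ u ∈ s, G.w v u) * ‖f v‖ ^ 2 ≤ D * ‖f v‖ ^ 2 := by gcongr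
      nlinarith
    calc _ ≤ _ := hcs
      _ ≤ D * (2 * D * ‖f v‖ ^ 2 + 2 * ∑' u, G.w v u * ‖f u‖ ^ 2) := by
          refine mul_le_mul hw hb (Finset.sum_nonneg fun u _ =>
            mul_nonneg (G.nonneg v u) (by positivity)) hD0
      _ = _ := by ring
  calc _ ≤ (∑' u, G.w v u * ‖f v - f u‖) ^ 2 := by gcongr
    _ ≤ _ := h2

theorem sum_sq_le (f : EllTwo V) (s : Finset V) : ∑ v ∈ s, ‖f v‖ ^ 2 ≤ ‖f‖ ^ 2 := by
  simpa using lp.sum_rpow_le_norm_rpow (p := 2) (by norm_num) f s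

theorem sum_norm_lapFun_sq_le {D : ℝ} (hD0 : 0 ≤ D) (hD : ∀ v, G.degree v ≤ D) (f : EllTwo V)
    (s : Finset V) : ∑ v ∈ s, ‖G.lapFun f v‖ ^ 2 ≤ (2 * D * ‖f‖) ^ 2 := by
  have h1 : ∑ v ∈ s, ∑' u, G.w v u * ‖f u‖ ^ 2 ≤ D * ‖f‖ ^ 2 := by
    rw [← Summable.tsum_finsetSum fun v _ => G.summable_weight_mul_sq f v]
    refine Summable.tsum_le_of_sum_le (summable_sum fun v _ => G.summable_weight_mul_sq f v)
      fun t => ?_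
    have : ∀ u, ∑ v ∈ s, G.w v u * ‖f u‖ ^ 2 ≤ D * ‖f u‖ ^ 2 := fun u => by
      rw [← Finset.sum_mul]
      gcongr
      rw [Finset.sum_congr rfl fun v _ => G.symm v u]
      exact ((G.summable u).sum_le_tsum s (fun v _ => G.nonneg u v)).trans (hD u)
    refine (Finset.sum_le_sum fun u _ => this u).trans ?_
    rw [← Finset.mul_sum]
    gcongr
    exact sum_sq_le f t
  calc _ ≤ ∑ v ∈ s, (2 * D ^ 2 * ‖f v‖ ^ 2 + 2 * D * ∑' u, G.w v u * ‖f u‖ ^ 2) :=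
        Finset.sum_le_sum fun v _ => G.norm_lapFun_sq_le hD f v
    _ = 2 * D ^ 2 * ∑ v ∈ s, ‖f v‖ ^ 2 + 2 * D * ∑ v ∈ s, ∑' u, G.w v u * ‖f u‖ ^ 2 := by
        rw [Finset.sum_add_distrib, Finset.mul_sum, Finset.mul_sum]
    _ ≤ 2 * D ^ 2 * ‖f‖ ^ 2 + 2 * D * (D * ‖f‖ ^ 2) := by
        gcongr
        exact sum_sq_le f s
    _ = _ := by ring

theorem memlp_lapFun (hG : G.BddDegree) (f : EllTwo V) : Memℓp (G.lapFun f) 2 := by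
  obtain ⟨D, hD⟩ := hG
  rcases isEmpty_or_nonempty V with hV | ⟨⟨v⟩⟩
  · rw [Subsingleton.elim (G.lapFun f) 0]
    exact zero_memℓp
  · refine memℓp_gen' (C := (2 * D * ‖f‖) ^ 2) fun s => ?_
    simpa using G.sum_norm_lapFun_sq_le ((G.degree_nonneg v).trans (hD v)) hD f s

/-- The Laplacian `(L f)(v) = ∑ u, w(v, u) (f v - f u)` of a weighted graph with bounded degrees,
as a bounded operator on `ℓ²(V)`. -/
def laplacian (hG : G.BddDegree) : EllTwo V →L[ℂ] EllTwo V :=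
  LinearMap.mkContinuousOfExistsBound
    { toFun := fun f => ⟨G.lapFun f, G.memlp_lapFun hG f⟩
      map_add' := fun f g => by
        ext v
        change G.lapFun (f + g) v = G.lapFun f v + G.lapFun g v
        unfold lapFun
        rw [← (G.summable_lapFun f v).tsum_add (G.summable_lapFun g v)]
        refine tsum_congr fun u => ?_
        simp only [Pi.add_apply]
        ring
      map_smul' := fun c f => by
        ext v
        change G.lapFun (c • f : V → ℂ) v = c * G.lapFun f v
        unfold lapFun
        rw [← tsum_mul_left]
        refine tsum_congr fun u => ?_
        simp only [Pi.smul_apply, smul_eq_mul]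
        ring }
    (by
      obtain ⟨D, hD⟩ := hG
      rcases isEmpty_or_nonempty V with hV | ⟨⟨v⟩⟩
      · exact ⟨0, fun f => by
          have : ∀ g : EllTwo V, g = 0 := fun g => by ext v; exact isEmptyElim v
          exact (congrArg norm (this _)).trans_le (by simp)⟩
      · have hD0 := (G.degree_nonneg v).trans (hD v)
        refine ⟨2 * D, fun f => ?_⟩
        refine lp.norm_le_of_forall_sum_le (by norm_num) (by positivity) fun s => ?_
        simpa using G.sum_norm_lapFun_sq_le hD0 hD f s)

theorem laplacian_apply (hG : G.BddDegree) (f : EllTwo V) (v : V) :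
    G.laplacian hG f v = ∑' u, (G.w v u : ℂ) * (f v - f u) := rfl

theorem isSelfAdjoint_laplacian (hG : G.BddDegree) : IsSelfAdjoint (G.laplacian hG) := by
  classical
  have key : ∀ a b : V, G.laplacian hG (lp.single 2 a 1) b =
      starRingEnd ℂ (G.laplacian hG (lp.single 2 b 1) a) := by
    intro a b
    by_cases hab : a = b
    · subst hab
      simp only [laplacian_apply, Complex.conj_tsum]
      refine tsum_congr fun u => ?_
      by_cases hu : u = a
      · subst hu; simp
      · simp [lp.single_apply, hu]
    · have h1 : ∀ a b : V, a ≠ b → G.laplacian hG (lp.single 2 a 1) b = -(G.w b a : ℂ) := by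
        intro a b hab
        rw [laplacian_apply, tsum_eq_single a]
        · simp [lp.single_apply, hab.symm]
        · intro u hu
          simp [lp.single_apply, hab.symm, hu]
      rw [h1 a b hab, h1 b a (Ne.symm hab), G.symm]
      simp
  rw [ContinuousLinearMap.isSelfAdjoint_iff']
  refine lp.ext_continuousLinearMap (by norm_num) fun a => ?_
  ext b
  have h2 := lp.inner_single_left (𝕜 := ℂ) (G := fun _ : V => ℂ) b (1 : ℂ)
    (ContinuousLinearMap.adjoint (G.laplacian hG) (lp.single 2 a 1))
  rw [ContinuousLinearMap.adjoint_inner_right, lp.inner_single_right] at h2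
  simp at h2
  simp [key a b, ← h2]

/-- The first (that is, the smallest) nonzero eigenvalue of the Laplacian of the induced graph on
the finite set `S`. -/
def firstEigenvalue (S : Finset V) : ℝ :=
  sInf {μ : ℝ | μ ≠ 0 ∧ Module.End.HasEigenvalue
    ((G.induce S).laplacian (G.induce S).bddDegree_of_finite : EllTwo S →ₗ[ℂ] EllTwo S) (μ : ℂ)}

end WeightedGraph

open Classical in
/-- The characteristic function of a finite set of vertices, as an element of `ℓ²(V)`. -/
def charFun {V : Type*} (S : Finset V) : EllTwo V := ∑ v ∈ S, lp.single 2 v (1 : ℂ)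

/-- `θ = |S| ‖ψ‖² / |Ψ(χ_S)|²`, where `Ψ(f) = ⟨f, ψ⟩`. -/
def theta {V : Type*} (S : Finset V) (ψ : EllTwo V) : ℝ :=
  (S.card : ℝ) * ‖ψ‖ ^ 2 / ‖⟪ψ, charFun S⟫_ℂ‖ ^ 2

/-! ## Spectral projections and Paley-Wiener spaces -/

section Spectral

variable {H : Type*} [NormedAddCommGroup H] [InnerProductSpace ℂ H] [CompleteSpace H]

/-- The spectral projection `1_K(T)` of a bounded self-adjoint operator `T` for a nonempty closed
set `K ⊆ ℝ`: the orthogonal projection onto the kernel of `d(T)`, where `d(x)` is the distance from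
`x` to `K`.  The next theorem shows that it is the value at `1_K` of the functional calculus of
`T`. -/
def spectralProjection (T : H →L[ℂ] H) (K : Set ℝ) : H →L[ℂ] H :=
  (cfc (fun x : ℝ => Metric.infDist x K) T).ker.starProjection

/-- `1_K(T)` is the strong limit of `g_n(T)` for the continuous functions
`g_n(x) = max(0, 1 - n d(x, K))`, which decrease pointwise to the indicator function `1_K`. -/
theorem tendsto_cfc_spectralProjection (T : H →L[ℂ] H) (hT : IsSelfAdjoint T) (K : Set ℝ) (f : H) :
    Filter.Tendsto (fun n : ℕ => cfc (fun x : ℝ => max 0 (1 - n * Metric.infDist x K)) T f)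
      Filter.atTop (𝓝 (spectralProjection T K f)) := by
  set d : ℝ → ℝ := fun x => Metric.infDist x K with hd
  have hdc : Continuous d := Metric.continuous_infDist_pt K
  have hd0 : ∀ x, 0 ≤ d x := fun x => Metric.infDist_nonneg
  set g : ℕ → ℝ → ℝ := fun n x => max 0 (1 - n * d x) with hg
  have hgc : ∀ n, Continuous (g n) := fun n => by fun_prop
  set N := (cfc d T).ker with hN
  have hsa : IsSelfAdjoint (cfc d T) := cfc_predicate d T
  -- `g n (T)` is the identity on the kernel of `d(T)`
  have h1 : ∀ n, ∀ y ∈ N, cfc (g n) T y = y := by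
    intro n y hy
    set h : ℝ → ℝ := fun x => n / max 1 (n * d x) with hh
    have hhc : Continuous h := continuous_const.div (by fun_prop) fun x =>
      (lt_of_lt_of_le one_pos (le_max_left _ _)).ne'
    have hgh : g n = fun x => 1 - h x * d x := by
      funext x
      simp only [hg, hh]
      rcases le_total (n * d x) 1 with h | h
      · rw [max_eq_left h, max_eq_right (by linarith)]; ring
      · rw [max_eq_right h, max_eq_left (by linarith)]
        have h0 : (n : ℝ) * d x ≠ 0 := by linarith
        rw [div_mul_eq_mul_div, div_self h0, sub_self]
    have hy0 : cfc d T y = 0 := hy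
    rw [hgh, cfc_sub (fun _ => (1 : ℝ)) (fun x => h x * d x) T continuousOn_const
      (hhc.mul hdc).continuousOn, cfc_mul h d T hhc.continuousOn hdc.continuousOn,
      cfc_const_one ℝ T]
    simp [hy0]
  have h2 : ∀ n, ‖cfc (g n) T‖ ≤ 1 := fun n => norm_cfc_le zero_le_one fun x _ => by
    have : 0 ≤ n * d x := mul_nonneg n.cast_nonneg (hd0 x)
    rw [Real.norm_of_nonneg (le_max_left _ _)]
    exact max_le zero_le_one (by linarith)
  -- `g n (T)` tends to zero on the range of `d(T)`
  have h3 : ∀ n : ℕ, ∀ x, ‖cfc (g (n + 1)) T (cfc d T x)‖ ≤ 1 / ((n : ℝ) + 1) * ‖x‖ := by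
    intro n x
    change ‖(cfc (g (n + 1)) T * cfc d T) x‖ ≤ _
    rw [← cfc_mul (g (n + 1)) d T (hgc _).continuousOn
      hdc.continuousOn]
    refine (ContinuousLinearMap.le_opNorm _ _).trans ?_
    gcongr
    refine norm_cfc_le (by positivity) fun x _ => ?_
    have hn : (0 : ℝ) < n + 1 := by positivity
    rw [Real.norm_of_nonneg (mul_nonneg (le_max_left _ _) (hd0 x)), le_div_iff₀ hn]
    simp only [Nat.cast_add, Nat.cast_one]
    have := hd0 x
    rcases le_total 0 (1 - (n + 1) * d x) with h | h
    · rw [max_eq_right h]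
      nlinarith [mul_nonneg hn.le this]
    · rw [max_eq_left h]; simp
  have h4 : f - N.starProjection f ∈ closure (Set.range fun y => cfc d T y) := by
    have h5 : f - N.starProjection f ∈ Nᗮ := Submodule.sub_starProjection_mem_orthogonal f
    have h6 : Nᗮ = (cfc d T).range.topologicalClosure := by
      rw [hN, ContinuousLinearMap.orthogonal_ker, hsa.adjoint_eq]
    have h7 : f - N.starProjection f ∈ (cfc d T).range.topologicalClosure := h6 ▸ h5
    rw [← SetLike.mem_coe, Submodule.topologicalClosure_coe] at h7
    exact h7
  rw [Metric.tendsto_atTop]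
  intro ε hε
  obtain ⟨_, ⟨x, rfl⟩, hx⟩ := Metric.mem_closure_iff.1 h4 (ε / 2) (half_pos hε)
  obtain ⟨m, hm⟩ := exists_nat_gt (2 * ‖x‖ / ε)
  refine ⟨m + 1, fun n hn => ?_⟩
  obtain ⟨n, rfl⟩ : ∃ k, n = k + 1 := ⟨n - 1, by omega⟩
  have hmn : (m : ℝ) ≤ n := by exact_mod_cast (by omega : m ≤ n)
  have h7 : cfc (g (n + 1)) T f - N.starProjection f =
      cfc (g (n + 1)) T (f - N.starProjection f - cfc d T x) +
        cfc (g (n + 1)) T (cfc d T x) := by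
    rw [map_sub, map_sub, h1 _ _ (Submodule.starProjection_apply_mem N f)]
    abel
  have h8 : ‖cfc (g (n + 1)) T (f - N.starProjection f - cfc d T x)‖ < ε / 2 := by
    refine lt_of_le_of_lt ?_ (by rwa [dist_eq_norm] at hx)
    exact (ContinuousLinearMap.le_of_opNorm_le _ (h2 _) _).trans_eq (one_mul _)
  have h9 : 1 / ((n : ℝ) + 1) * ‖x‖ ≤ ε / 2 := by
    rw [div_lt_iff₀ hε] at hm
    rw [div_mul_eq_mul_div, one_mul, div_le_iff₀ (by positivity)]
    nlinarith
  change dist (cfc (g (n + 1)) T f) (N.starProjection f) < ε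
  rw [dist_eq_norm, h7]
  calc _ ≤ _ := norm_add_le _ _
    _ < ε := by linarith [h3 n x]

/-- The Paley-Wiener space `PW_ω(L)`: the image of the projection `1_{[0, ω]}(L)`. -/
def paleyWiener (L : H →L[ℂ] H) (ω : ℝ) : Submodule ℂ H :=
  LinearMap.range (spectralProjection L (Set.Icc 0 ω) : H →ₗ[ℂ] H)

/-- The orthogonal projection of `H` onto `PW_ω(L)`. -/
def pwProj (L : H →L[ℂ] H) (ω : ℝ) (g : H) : paleyWiener L ω :=
  ⟨spectralProjection L (Set.Icc 0 ω) g, g, rfl⟩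

end Spectral

/-! ## Frames -/

section Frames

variable {J H : Type*} [NormedAddCommGroup H] [InnerProductSpace ℂ H]

/-- `ξ` is a Hilbert frame of `H` with frame bounds `A` and `B`. -/
structure IsFrame (ξ : J → H) (A B : ℝ) : Prop where
  lower_pos : 0 < A
  upper_pos : 0 < B
  summable : ∀ f : H, Summable fun j => ‖⟪ξ j, f⟫_ℂ‖ ^ 2
  lower : ∀ f : H, A * ‖f‖ ^ 2 ≤ ∑' j, ‖⟪ξ j, f⟫_ℂ‖ ^ 2
  upper : ∀ f : H, ∑' j, ‖⟪ξ j, f⟫_ℂ‖ ^ 2 ≤ B * ‖f‖ ^ 2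

/-- The frame operator `Φ f = ∑ j, ⟨f, ξ_j⟩ ξ_j`. -/
def frameOperator (ξ : J → H) (f : H) : H := ∑' j, ⟪ξ j, f⟫_ℂ • ξ j

/-- The frame algorithm with relaxation parameter `ρ` run on the data `c : J → ℂ`:
`f₀ = 0` and `f_{n+1} = f_n + ρ ∑ j, (c_j - ⟨f_n, ξ_j⟩) ξ_j`.  For `c_j = ⟨f, ξ_j⟩` the increment
is `ρ Φ(f - f_n)`. -/
def frameAlgorithm (ξ : J → H) (ρ : ℝ) (c : J → ℂ) : ℕ → H
  | 0 => 0
  | n + 1 => frameAlgorithm ξ ρ c n +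
      ρ • ∑' j, (c j - ⟪ξ j, frameAlgorithm ξ ρ c n⟫_ℂ) • ξ j

theorem frameAlgorithm_samples_succ (ξ : J → H) (ρ : ℝ) (f : H) (n : ℕ) :
    frameAlgorithm ξ ρ (fun j => ⟪ξ j, f⟫_ℂ) (n + 1) =
      frameAlgorithm ξ ρ (fun j => ⟪ξ j, f⟫_ℂ) n +
        ρ • frameOperator ξ (f - frameAlgorithm ξ ρ (fun j => ⟪ξ j, f⟫_ℂ) n) := by
  simp only [frameAlgorithm, frameOperator, inner_sub_right]

end Frames

end

/-! Lower frame bound. On one set of the cover, split `f` into its mean and a mean-zero part `g`.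
The Poincaré inequality bounds `‖g‖²` by the energy inside the set divided by the first eigenvalue.
Projecting obliquely along the characteristic function onto the kernel of the functional replaces
the unknown mean by the sample. The squared cost on `g` is at most `theta`, and
`norm_add_sq_le_weighted` adds the factor `1 + ε` (`sum_norm_sq_le_energyOn`). Distinct sets share
no edge, so the local energies add up to at most `⟨L f, f⟩` (`sum_energyOn_le`), which is at most `ω
‖f‖²` on the Paley-Wiener space (`re_inner_le_of_mem_paleyWiener`). Hence `‖f‖² ≤ γ ‖f‖² +` a
multiple of the sample energy, and `γ < 1` lets the first term be absorbed.

Upper frame bound. Cauchy-Schwarz on each set reduces it to bounded multiplicity. Testing the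
Poincaré inequality on a point mass shows that each set containing `v` uses a definite amount of the
degree of `v` (`firstEigenvalue_le_sum_weight`), so there can be only boundedly many.

The rest is abstract frame theory. The frame operator `Φ` is coercive, hence invertible, and `Φ⁻¹
ξ_j` is the dual frame. The frame algorithm iterates the contraction `1 - ρ Φ`, and noise `e` in the
data amounts to replacing `f` by `f + Φ⁻¹ ∑ e_j ξ_j` (`frameAlgorithm_add`). -/

noncomputable section

/-! ## Square summable families -/

section EllTwo

variable {J : Type*}

/-- A square summable family as an element of `ℓ²(J)`. -/
def EllTwo.ofSummable (e : J → ℂ) (he : Summable fun j => ‖e j‖ ^ 2) : EllTwo J :=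
  ⟨e, memℓp_gen (by simpa using he)⟩

@[simp] theorem EllTwo.ofSummable_apply (e : J → ℂ) (he : Summable fun j => ‖e j‖ ^ 2) (j : J) :
    EllTwo.ofSummable e he j = e j := rfl

theorem EllTwo.hasSum_sq (f : EllTwo J) : HasSum (fun j => ‖f j‖ ^ 2) (‖f‖ ^ 2) := by
  simpa using lp.hasSum_norm (p := 2) (by norm_num) f

theorem EllTwo.norm_ofSummable (e : J → ℂ) (he : Summable fun j => ‖e j‖ ^ 2) :
    ‖EllTwo.ofSummable e he‖ = √(∑' j, ‖e j‖ ^ 2) := by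
  rw [← Real.sqrt_sq (norm_nonneg (EllTwo.ofSummable e he)),
    ← (EllTwo.hasSum_sq (EllTwo.ofSummable e he)).tsum_eq]
  rfl

end EllTwo

/-! ## Frames, their dual frames and the frame algorithm -/

section Frames

variable {J H : Type*} [NormedAddCommGroup H] [InnerProductSpace ℂ H]

/-- A symmetric operator whose quadratic form is bounded by `η` has norm at most `η`. -/
theorem norm_apply_le_of_abs_re_inner_le (M : H →L[ℂ] H)
    (hM : ∀ x y, ⟪M x, y⟫_ℂ = ⟪x, M y⟫_ℂ) {η : ℝ} (hη0 : 0 ≤ η)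
    (hη : ∀ x, |(⟪M x, x⟫_ℂ).re| ≤ η * ‖x‖ ^ 2) (x : H) : ‖M x‖ ≤ η * ‖x‖ := by
  -- Polarization: subtract the forms at `x + y` and `x - y`, then apply the parallelogram law.
  have hpol : ∀ x y, 4 * (⟪M x, y⟫_ℂ).re ≤ 2 * η * (‖x‖ ^ 2 + ‖y‖ ^ 2) := by
    intro x y
    have h1 := (abs_le.1 (hη (x + y))).2
    have h2 := (abs_le.1 (hη (x - y))).1
    have h3 : (⟪M y, x⟫_ℂ).re = (⟪M x, y⟫_ℂ).re := by
      rw [hM y x, ← inner_conj_symm, Complex.conj_re]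
    have h4 := parallelogram_law_with_norm ℂ x y
    simp only [map_add, map_sub, inner_add_left, inner_add_right, inner_sub_left, inner_sub_right,
      Complex.add_re, Complex.sub_re, h3] at h1 h2
    nlinarith
  rcases eq_or_ne (M x) 0 with h0 | h0
  · rw [h0, norm_zero]; positivity
  have hMx : 0 < ‖M x‖ := norm_pos_iff.2 h0
  -- The test vector points along `M x` and is scaled to the norm of `x`.
  have h5 := hpol x (((‖x‖ / ‖M x‖ : ℝ) : ℂ) • M x)
  rw [inner_smul_right, inner_self_eq_norm_sq_to_K, norm_smul, Complex.norm_real,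
    Real.norm_of_nonneg (by positivity), div_mul_cancel₀ _ hMx.ne'] at h5
  have h6 : ((((‖x‖ / ‖M x‖ : ℝ) : ℂ) * ((‖M x‖ : ℂ)) ^ 2)).re = ‖x‖ * ‖M x‖ := by
    rw [← Complex.ofReal_pow, ← Complex.ofReal_mul, Complex.ofReal_re]
    field_simp
  have h7 : 4 * (‖x‖ * ‖M x‖) ≤ 4 * (‖x‖ * (η * ‖x‖)) := by
    rw [← h6]; refine h5.trans_eq (by ring)
  rcases (norm_nonneg x).eq_or_lt with hx | hx
  · have : x = 0 := norm_eq_zero.1 hx.symm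
    simp [this] at h0
  · exact le_of_mul_le_mul_left (le_of_mul_le_mul_left h7 four_pos) hx

/-! ### Analysis, synthesis, the frame operator and the dual frame -/

namespace IsFrame

variable {ξ : J → H} {A B : ℝ} (h : IsFrame ξ A B)
include h

/-- The analysis operator `f ↦ (⟨f, ξ_j⟩)_j` of a frame. -/
def analysis : H →L[ℂ] EllTwo J :=
  LinearMap.mkContinuousOfExistsBound
    { toFun := fun f => EllTwo.ofSummable (fun j => ⟪ξ j, f⟫_ℂ) (h.summable f)
      map_add' := fun f g => by ext j; exact inner_add_right _ _ _
      map_smul' := fun c f => by ext j; exact inner_smul_right _ _ _ }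
    ⟨√B, fun f => by
      change ‖EllTwo.ofSummable (fun j => ⟪ξ j, f⟫_ℂ) (h.summable f)‖ ≤ _
      rw [EllTwo.norm_ofSummable]
      refine (Real.sqrt_le_sqrt (h.upper f)).trans_eq ?_
      rw [Real.sqrt_mul h.upper_pos.le, Real.sqrt_sq (norm_nonneg f)]⟩

@[simp] theorem analysis_apply (f : H) (j : J) : h.analysis f j = ⟪ξ j, f⟫_ℂ := rfl

theorem norm_analysis_sq (f : H) : ‖h.analysis f‖ ^ 2 = ∑' j, ‖⟪ξ j, f⟫_ℂ‖ ^ 2 :=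
  (EllTwo.hasSum_sq (h.analysis f)).tsum_eq.symm

theorem norm_analysis_le (f : H) : ‖h.analysis f‖ ≤ √B * ‖f‖ := by
  refine Real.le_sqrt_of_sq_le (y := B * ‖f‖ ^ 2) ?_ |>.trans_eq ?_
  · rw [h.norm_analysis_sq]; exact h.upper f
  · rw [Real.sqrt_mul h.upper_pos.le, Real.sqrt_sq (norm_nonneg f)]

theorem le_norm_analysis_sq (f : H) : A * ‖f‖ ^ 2 ≤ ‖h.analysis f‖ ^ 2 := by
  rw [h.norm_analysis_sq]; exact h.lower f

variable [CompleteSpace H]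

/-- The synthesis operator `(e_j)_j ↦ ∑ j, e_j ξ_j` of a frame. -/
def synthesis : EllTwo J →L[ℂ] H := ContinuousLinearMap.adjoint h.analysis

theorem inner_synthesis_left (e : EllTwo J) (f : H) :
    ⟪h.synthesis e, f⟫_ℂ = ⟪e, h.analysis f⟫_ℂ :=
  ContinuousLinearMap.adjoint_inner_left _ _ _

theorem inner_synthesis_right (e : EllTwo J) (f : H) :
    ⟪f, h.synthesis e⟫_ℂ = ⟪h.analysis f, e⟫_ℂ :=
  ContinuousLinearMap.adjoint_inner_right _ _ _

theorem hasSum_synthesis (e : EllTwo J) : HasSum (fun j => e j • ξ j) (h.synthesis e) := by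
  classical
  have h1 := (lp.hasSum_single (p := 2) (by norm_num) e).mapL h.synthesis
  refine h1.congr_fun fun j => ?_
  refine ext_inner_right ℂ fun f => ?_
  rw [h.inner_synthesis_left, lp.inner_single_left]
  simp [inner_smul_left, mul_comm]

theorem norm_synthesis_le (e : EllTwo J) : ‖h.synthesis e‖ ≤ √B * ‖e‖ := by
  refine ContinuousLinearMap.le_of_opNorm_le _ ?_ e
  rw [synthesis, LinearIsometryEquiv.norm_map]
  exact ContinuousLinearMap.opNorm_le_bound _ (Real.sqrt_nonneg _) h.norm_analysis_le

/-- The frame operator `Φ f = ∑ j, ⟨f, ξ_j⟩ ξ_j` as a bounded operator. -/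
def operator : H →L[ℂ] H := h.synthesis ∘L h.analysis

theorem operator_apply (f : H) : h.operator f = h.synthesis (h.analysis f) := rfl

theorem inner_operator_comm (f g : H) : ⟪h.operator f, g⟫_ℂ = ⟪f, h.operator g⟫_ℂ := by
  rw [operator_apply, operator_apply, h.inner_synthesis_left, h.inner_synthesis_right]

theorem re_inner_operator_self (f : H) : (⟪h.operator f, f⟫_ℂ).re = ‖h.analysis f‖ ^ 2 := by
  rw [operator_apply, h.inner_synthesis_left]
  exact (norm_sq_eq_re_inner (𝕜 := ℂ) _).symm

/-- The lower frame bound makes the quadratic form of `Φ` coercive, as in Lax-Milgram. -/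
theorem isUnit_operator : IsUnit h.operator := by
  refine ContinuousLinearMap.isUnit_of_forall_le_norm_inner_map _ (c := ⟨A, h.lower_pos.le⟩)
    h.lower_pos fun f => ?_
  refine le_trans ?_ (Complex.re_le_norm _)
  rw [h.re_inner_operator_self]
  refine le_trans (le_of_eq ?_) (h.le_norm_analysis_sq f)
  exact mul_comm _ _

/-- The inverse of the frame operator. -/
def inverse : H →L[ℂ] H := Ring.inverse h.operator

@[simp] theorem operator_inverse (f : H) : h.operator (h.inverse f) = f :=
  congr($(Ring.mul_inverse_cancel _ h.isUnit_operator) f)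

@[simp] theorem inverse_operator (f : H) : h.inverse (h.operator f) = f :=
  congr($(Ring.inverse_mul_cancel _ h.isUnit_operator) f)

theorem inner_inverse_left (f g : H) : ⟪h.inverse f, g⟫_ℂ = ⟪f, h.inverse g⟫_ℂ := by
  conv_lhs => rw [← h.operator_inverse g]
  rw [← h.inner_operator_comm, h.operator_inverse]

/-- The canonical dual frame. -/
def dual (j : J) : H := h.inverse (ξ j)

theorem inner_dual (f : H) (j : J) : ⟪h.dual j, f⟫_ℂ = ⟪ξ j, h.inverse f⟫_ℂ :=
  h.inner_inverse_left _ _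

theorem hasSum_dual_smul (e : EllTwo J) :
    HasSum (fun j => e j • h.dual j) (h.inverse (h.synthesis e)) := by
  simpa [Function.comp_def, dual] using (h.hasSum_synthesis e).mapL h.inverse

theorem hasSum_inner_smul_dual (f : H) : HasSum (fun j => ⟪ξ j, f⟫_ℂ • h.dual j) f := by
  simpa [← h.operator_apply] using h.hasSum_dual_smul (h.analysis f)

/-- The canonical dual frame has bounds `B⁻¹` and `A⁻¹` for all frame bounds `A`, `B`. -/
theorem isFrame_dual {A' B' : ℝ} (h' : IsFrame ξ A' B') : IsFrame h.dual B'⁻¹ A'⁻¹ := by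
  have key : ∀ f, ∑' j, ‖⟪h.dual j, f⟫_ℂ‖ ^ 2 = ‖h'.analysis (h.inverse f)‖ ^ 2 := fun f => by
    rw [h'.norm_analysis_sq]
    exact tsum_congr fun j => by rw [h.inner_dual]
  -- The bounds enter the frame operator only through proofs, so the operators of `h` and `h'` are
  -- definitionally equal.
  have hop : ∀ f, h'.operator (h.inverse f) = f := fun f => h.operator_inverse f
  refine ⟨inv_pos.2 h'.upper_pos, inv_pos.2 h'.lower_pos, fun f => ?_, fun f => ?_, fun f => ?_⟩
  · simpa only [h.inner_dual] using h.summable (h.inverse f)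
  · rw [key, inv_mul_le_iff₀ h'.upper_pos]
    -- `f` is the synthesis of the analysis of `Φ⁻¹ f`, and synthesis has norm at most `√B'`.
    have h1 := h'.norm_synthesis_le (h'.analysis (h.inverse f))
    rw [← operator_apply, hop] at h1
    calc ‖f‖ ^ 2 ≤ (√B' * ‖h'.analysis (h.inverse f)‖) ^ 2 := by gcongr
      _ = _ := by rw [mul_pow, Real.sq_sqrt h'.upper_pos.le]
  · rw [key, le_inv_mul_iff₀ h'.lower_pos]
    set g := h.inverse f
    have h1 := h'.le_norm_analysis_sq g
    -- With `A' ‖g‖² ≤ ‖h'.analysis g‖²` this gives `A' ‖g‖ ≤ ‖f‖`; inserting that back yields the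
    -- sharp constant.
    have h2 : ‖h'.analysis g‖ ^ 2 ≤ ‖f‖ * ‖g‖ := by
      rw [← h'.re_inner_operator_self, hop]
      exact (Complex.re_le_norm _).trans (norm_inner_le_norm _ _)
    have hA := h'.lower_pos
    rcases (norm_nonneg g).eq_or_lt with hg | hg
    · rw [← hg, mul_zero] at h2
      nlinarith [sq_nonneg ‖f‖]
    · have h3 : A' * ‖g‖ ≤ ‖f‖ := by
        refine le_of_mul_le_mul_right ?_ hg
        nlinarith
      nlinarith [norm_nonneg f]

/-- `Φ⁻¹` of the synthesis is synthesis with the dual frame, whose upper bound is `A'⁻¹`. -/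
theorem norm_inverse_synthesis_le {A' B' : ℝ} (h' : IsFrame ξ A' B') (e : EllTwo J) :
    ‖h.inverse (h.synthesis e)‖ ≤ 1 / √A' * ‖e‖ := by
  have h1 := (h.isFrame_dual h').hasSum_synthesis e
  rw [(h.hasSum_dual_smul e).unique h1, one_div, ← Real.sqrt_inv]
  exact (h.isFrame_dual h').norm_synthesis_le e

/-! ### Convergence and stability of the frame algorithm -/

theorem frameOperator_eq (f : H) : frameOperator ξ f = h.operator f :=
  (h.hasSum_synthesis (h.analysis f)).tsum_eq

omit [CompleteSpace H] in
theorem abs_max_lt_one {ρ : ℝ} (hAB : A ≤ B) (hρ : 0 < ρ) (hρB : ρ < 2 / B) :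
    max |1 - ρ * A| |1 - ρ * B| < 1 := by
  rw [lt_div_iff₀ h.upper_pos] at hρB
  have h1 : 0 < ρ * A := mul_pos hρ h.lower_pos
  have h2 : ρ * A ≤ ρ * B := by gcongr
  exact max_lt (abs_lt.2 ⟨by linarith, by linarith⟩) (abs_lt.2 ⟨by linarith, by linarith⟩)

/-- One step of the frame algorithm contracts the error. -/
theorem norm_sub_smul_operator_le {ρ : ℝ} (hρ : 0 < ρ) (f : H) :
    ‖f - ρ • h.operator f‖ ≤ max |1 - ρ * A| |1 - ρ * B| * ‖f‖ := by
  refine norm_apply_le_of_abs_re_inner_le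
    (ContinuousLinearMap.id ℂ H - (ρ : ℂ) • h.operator) (fun x y => ?_)
    (le_max_of_le_left (abs_nonneg _)) (fun x => ?_) f
  · simp [h.inner_operator_comm]
  -- The frame bounds place the form of `1 - ρ Φ` between `1 - ρ B` and `1 - ρ A` times `‖x‖²`.
  · have h1 : (⟪(ContinuousLinearMap.id ℂ H - (ρ : ℂ) • h.operator) x, x⟫_ℂ).re =
        ‖x‖ ^ 2 - ρ * ‖h.analysis x‖ ^ 2 := by
      have h0 : (⟪x, x⟫_ℂ).re = ‖x‖ ^ 2 := (norm_sq_eq_re_inner (𝕜 := ℂ) x).symm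
      change (⟪x - (ρ : ℂ) • h.operator x, x⟫_ℂ).re = _
      rw [inner_sub_left, inner_smul_left, Complex.conj_ofReal, Complex.sub_re, h0,
        Complex.re_ofReal_mul, h.re_inner_operator_self]
    have h2 := h.le_norm_analysis_sq x
    have h3 := h.upper x
    rw [← h.norm_analysis_sq] at h3
    have h4 := mul_le_mul_of_nonneg_left h2 hρ.le
    have h5 := mul_le_mul_of_nonneg_left h3 hρ.le
    have h6 : (1 - ρ * A) * ‖x‖ ^ 2 ≤ max |1 - ρ * A| |1 - ρ * B| * ‖x‖ ^ 2 := by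
      gcongr; exact (le_abs_self _).trans (le_max_left _ _)
    have h7 : -(1 - ρ * B) * ‖x‖ ^ 2 ≤ max |1 - ρ * A| |1 - ρ * B| * ‖x‖ ^ 2 := by
      gcongr; exact (neg_le_abs _).trans (le_max_right _ _)
    rw [h1, abs_le]
    constructor <;> nlinarith

theorem norm_sub_frameAlgorithm_le {ρ : ℝ} (hρ : 0 < ρ) (f : H) (n : ℕ) :
    ‖f - frameAlgorithm ξ ρ (fun j => ⟪ξ j, f⟫_ℂ) n‖ ≤
      max |1 - ρ * A| |1 - ρ * B| ^ n * ‖f‖ := by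
  induction n with
  | zero => simp [frameAlgorithm]
  | succ n ih =>
    rw [frameAlgorithm_samples_succ, h.frameOperator_eq, ← sub_sub]
    refine (h.norm_sub_smul_operator_le hρ _).trans ?_
    rw [pow_succ', mul_assoc]
    gcongr

/-- Perturbing the data by `e` has the effect of perturbing `f` by `Φ⁻¹ (∑ j, e_j ξ_j)`. -/
theorem frameAlgorithm_add (ρ : ℝ) (f : H) (e : EllTwo J) (n : ℕ) :
    frameAlgorithm ξ ρ (fun j => ⟪ξ j, f⟫_ℂ + e j) n =
      frameAlgorithm ξ ρ (fun j => ⟪ξ j, f + h.inverse (h.synthesis e)⟫_ℂ) n := by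
  induction n with
  | zero => rfl
  | succ n ih =>
    simp only [frameAlgorithm, ih]
    set g := frameAlgorithm ξ ρ (fun j => ⟪ξ j, f + h.inverse (h.synthesis e)⟫_ℂ) n
    have h1 := h.hasSum_synthesis (h.analysis f + e - h.analysis g)
    have h2 := h.hasSum_synthesis
      (h.analysis (f + h.inverse (h.synthesis e)) - h.analysis g)
    -- The two data sequences may differ, but `Φ (Φ⁻¹ y) = y` makes their syntheses agree, and the
    -- algorithm sees only those.
    have h3 : h.synthesis (h.analysis f + e - h.analysis g) =
        h.synthesis (h.analysis (f + h.inverse (h.synthesis e)) - h.analysis g) := by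
      simp [map_add, map_sub, ← h.operator_apply]
    have h4 := h1.tsum_eq.trans (h3.trans h2.tsum_eq.symm)
    simp only [lp.coeFn_add, lp.coeFn_sub, Pi.add_apply, Pi.sub_apply, analysis_apply] at h4
    rw [h4]

/-- The iterates head for `f + k` with `k = Φ⁻¹ ∑ e_j ξ_j`. The factor 2 counts `‖k‖` twice: in the
initial error `‖f + k‖` and in the passage from the limit back to `f`. -/
theorem norm_sub_frameAlgorithm_add_le {ρ : ℝ} (hAB : A ≤ B) (hρ : 0 < ρ) (hρB : ρ < 2 / B)
    (f : H) (e : EllTwo J) (n : ℕ) :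
    ‖f - frameAlgorithm ξ ρ (fun j => ⟪ξ j, f⟫_ℂ + e j) n‖ ≤
      max |1 - ρ * A| |1 - ρ * B| ^ n * ‖f‖ + 2 / √A * ‖e‖ := by
  rw [h.frameAlgorithm_add]
  set k := h.inverse (h.synthesis e) with hk
  set η := max |1 - ρ * A| |1 - ρ * B| with hη
  have hη0 : 0 ≤ η := le_max_of_le_left (abs_nonneg _)
  have hη1 : η ^ n ≤ 1 := pow_le_one₀ hη0 (h.abs_max_lt_one hAB hρ hρB).le
  have h1 : ‖k‖ ≤ 1 / √A * ‖e‖ := h.norm_inverse_synthesis_le h e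
  have h2 := h.norm_sub_frameAlgorithm_le hρ (f + k) n
  rw [← hη] at h2
  have h3 := norm_sub_le (f + k - frameAlgorithm ξ ρ (fun j => ⟪ξ j, f + k⟫_ℂ) n) k
  rw [show f + k - frameAlgorithm ξ ρ (fun j => ⟪ξ j, f + k⟫_ℂ) n - k =
    f - frameAlgorithm ξ ρ (fun j => ⟪ξ j, f + k⟫_ℂ) n by abel] at h3
  have h4 : η ^ n * ‖f + k‖ ≤ η ^ n * ‖f‖ + ‖k‖ := by
    have h5 : η ^ n * ‖f + k‖ ≤ η ^ n * (‖f‖ + ‖k‖) := by gcongr; exact norm_add_le _ _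
    nlinarith [norm_nonneg k]
  have h6 : 2 / √A * ‖e‖ = 1 / √A * ‖e‖ + 1 / √A * ‖e‖ := by ring
  linarith

end IsFrame

end Frames

/-! ## An oblique projection estimate -/

section Oblique

variable {E : Type*} [NormedAddCommGroup E] [InnerProductSpace ℂ E]

/-- Bessel's inequality for a pair of orthogonal vectors. -/
theorem norm_inner_sq_add_le_of_orthogonal (p χ g : E) (horth : ⟪χ, g⟫_ℂ = 0) :
    ‖⟪p, g⟫_ℂ‖ ^ 2 * ‖χ‖ ^ 2 + ‖⟪p, χ⟫_ℂ‖ ^ 2 * ‖g‖ ^ 2 ≤ ‖p‖ ^ 2 * ‖g‖ ^ 2 * ‖χ‖ ^ 2 := by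
  rcases eq_or_ne χ 0 with rfl | hχ
  · simp
  have hχ2 : 0 < ‖χ‖ ^ 2 := by positivity
  have hχ0 : ((‖χ‖ : ℂ)) ^ 2 ≠ 0 := by exact_mod_cast hχ2.ne'
  -- Only the component `q` of `p` orthogonal to `χ` pairs with `g`; Cauchy-Schwarz for `q` and
  -- Pythagoras for `p` finish.
  set q : E := p - (⟪χ, p⟫_ℂ / (‖χ‖ : ℂ) ^ 2) • χ with hq
  have hqχ : ⟪χ, q⟫_ℂ = 0 := by
    rw [hq, inner_sub_right, inner_smul_right, inner_self_eq_norm_sq_to_K]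
    exact sub_eq_zero.2 (div_mul_cancel₀ _ hχ0).symm
  have hp : p = q + (⟪χ, p⟫_ℂ / (‖χ‖ : ℂ) ^ 2) • χ := by rw [hq]; abel
  have hnp : ‖p‖ ^ 2 = ‖q‖ ^ 2 + ‖⟪p, χ⟫_ℂ‖ ^ 2 / ‖χ‖ ^ 2 := by
    have h1 := norm_add_sq_eq_norm_sq_add_norm_sq_of_inner_eq_zero q
      ((⟪χ, p⟫_ℂ / (‖χ‖ : ℂ) ^ 2) • χ)
      (by rw [inner_smul_right, inner_eq_zero_symm.1 hqχ, mul_zero])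
    rw [← hp, norm_smul, norm_div, norm_pow, Complex.norm_real, norm_norm, norm_inner_symm] at h1
    rw [sq, h1, sq ‖q‖]
    congr 1
    field_simp
  have hpg : ⟪p, g⟫_ℂ = ⟪q, g⟫_ℂ := by
    conv_lhs => rw [hp]
    rw [inner_add_left, inner_smul_left, horth, mul_zero, add_zero]
  have hcs : ‖⟪q, g⟫_ℂ‖ ^ 2 ≤ ‖q‖ ^ 2 * ‖g‖ ^ 2 := by
    rw [← mul_pow]; gcongr; exact norm_inner_le_norm _ _
  have hmul : ‖p‖ ^ 2 * ‖χ‖ ^ 2 = ‖q‖ ^ 2 * ‖χ‖ ^ 2 + ‖⟪p, χ⟫_ℂ‖ ^ 2 := by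
    rw [hnp]; field_simp
  rw [hpg]
  nlinarith [mul_le_mul_of_nonneg_right hcs hχ2.le]

-- After the triangle inequality, the slack is the square `(ε‖a‖ - ‖b‖)² / ε`.
omit [InnerProductSpace ℂ E] in
theorem norm_add_sq_le_weighted (a b : E) {ε : ℝ} (hε : 0 < ε) :
    ‖a + b‖ ^ 2 ≤ (1 + ε) * ‖a‖ ^ 2 + (1 + ε) / ε * ‖b‖ ^ 2 := by
  have h1 : ‖a + b‖ ^ 2 ≤ (‖a‖ + ‖b‖) ^ 2 := by gcongr; exact norm_add_le _ _
  have h2 : (1 + ε) * ‖a‖ ^ 2 + (1 + ε) / ε * ‖b‖ ^ 2 - (‖a‖ + ‖b‖) ^ 2 =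
      (ε * ‖a‖ - ‖b‖) ^ 2 / ε := by field_simp; ring
  have h3 : 0 ≤ (ε * ‖a‖ - ‖b‖) ^ 2 / ε := by positivity
  linarith

/-- If `x = g + m χ` with `g ⟂ χ`, then `x` is controlled by `g` and the functional `⟨·, p⟩`. -/
theorem norm_sq_le_of_inner_ne_zero (p χ g : E) (m : ℂ) (horth : ⟪χ, g⟫_ℂ = 0)
    (hp : ⟪p, χ⟫_ℂ ≠ 0) {ε : ℝ} (hε : 0 < ε) :
    ‖g + m • χ‖ ^ 2 ≤ (1 + ε) * (‖χ‖ ^ 2 * ‖p‖ ^ 2 / ‖⟪p, χ⟫_ℂ‖ ^ 2) * ‖g‖ ^ 2 +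
      (1 + ε) / ε * (‖χ‖ ^ 2 / ‖⟪p, χ⟫_ℂ‖ ^ 2 * ‖⟪p, g + m • χ⟫_ℂ‖ ^ 2) := by
  have ha : 0 < ‖⟪p, χ⟫_ℂ‖ := norm_pos_iff.2 hp
  -- Oblique splitting: the first summand is annihilated by `⟪p, ·⟫`, and the second depends only on
  -- the sample of `x`.
  have hx : g + m • χ = (g - (⟪p, g⟫_ℂ / ⟪p, χ⟫_ℂ) • χ) +
      (⟪p, g + m • χ⟫_ℂ / ⟪p, χ⟫_ℂ) • χ := by
    rw [inner_add_right, inner_smul_right, add_div, mul_div_cancel_right₀ _ hp, add_smul]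
    abel
  have h1 : ‖g - (⟪p, g⟫_ℂ / ⟪p, χ⟫_ℂ) • χ‖ ^ 2 ≤
      ‖χ‖ ^ 2 * ‖p‖ ^ 2 / ‖⟪p, χ⟫_ℂ‖ ^ 2 * ‖g‖ ^ 2 := by
    have h2 := norm_add_sq_eq_norm_sq_add_norm_sq_of_inner_eq_zero (𝕜 := ℂ) g
      (-((⟪p, g⟫_ℂ / ⟪p, χ⟫_ℂ) • χ))
      (by rw [inner_neg_right, inner_smul_right, inner_eq_zero_symm.1 horth, mul_zero, neg_zero])
    rw [sq, sub_eq_add_neg, h2, norm_neg, norm_smul, norm_div]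
    have h3 := norm_inner_sq_add_le_of_orthogonal p χ g horth
    rw [div_mul_eq_mul_div (‖χ‖ ^ 2 * ‖p‖ ^ 2), le_div_iff₀ (by positivity)]
    refine le_trans (le_of_eq ?_) (h3.trans_eq ?_)
    · field_simp; ring
    · ring
  have h4 := norm_add_sq_le_weighted (g - (⟪p, g⟫_ℂ / ⟪p, χ⟫_ℂ) • χ)
    ((⟪p, g + m • χ⟫_ℂ / ⟪p, χ⟫_ℂ) • χ) hε
  rw [← hx] at h4
  refine h4.trans (add_le_add ?_ ?_)
  · rw [mul_assoc]; gcongr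
  · rw [norm_smul, norm_div]
    gcongr
    exact le_of_eq (by field_simp)

end Oblique

/-! ## Truncation to finite sets -/

section Truncation

variable {V : Type*}

open Classical in
/-- The truncation of a function to a finite set, as an element of `ℓ²(V)`. -/
def EllTwo.truncate (S : Finset V) (g : V → ℂ) : EllTwo V :=
  EllTwo.ofSummable (fun v => if v ∈ S then g v else 0)
    (summable_of_ne_finset_zero (s := S) fun v hv => by simp [hv])

open Classical in
theorem EllTwo.truncate_apply (S : Finset V) (g : V → ℂ) (v : V) :
    EllTwo.truncate S g v = if v ∈ S then g v else 0 := rfl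

theorem EllTwo.norm_truncate_sq (S : Finset V) (g : V → ℂ) :
    ‖EllTwo.truncate S g‖ ^ 2 = ∑ v ∈ S, ‖g v‖ ^ 2 := by
  classical
  rw [← (EllTwo.hasSum_sq _).tsum_eq, tsum_eq_sum (s := S)]
  · exact Finset.sum_congr rfl fun v hv => by simp [truncate_apply, hv]
  · intro v hv
    simp [truncate_apply, hv]

theorem charFun_eq_truncate (S : Finset V) : charFun S = EllTwo.truncate S 1 := by
  classical
  ext v
  rw [charFun, lp.coeFn_sum, Finset.sum_apply]
  simp only [lp.single_apply, EllTwo.truncate_apply, Pi.one_apply, Pi.single_apply]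
  rw [Finset.sum_ite_eq]

theorem norm_charFun_sq (S : Finset V) : ‖charFun S‖ ^ 2 = S.card := by
  simp [charFun_eq_truncate, EllTwo.norm_truncate_sq]

theorem inner_charFun_truncate (S : Finset V) (g : V → ℂ) :
    ⟪charFun S, EllTwo.truncate S g⟫_ℂ = ∑ v ∈ S, g v := by
  classical
  rw [charFun_eq_truncate, lp.inner_eq_tsum, tsum_eq_sum (s := S)]
  · exact Finset.sum_congr rfl fun v hv => by simp [EllTwo.truncate_apply, hv]
  · intro v hv
    simp [EllTwo.truncate_apply, hv]

theorem inner_truncate_of_support {S : Finset V} {p : EllTwo V} (hp : ∀ v, v ∉ S → p v = 0)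
    (f : EllTwo V) : ⟪p, EllTwo.truncate S f⟫_ℂ = ⟪p, f⟫_ℂ := by
  classical
  rw [lp.inner_eq_tsum, lp.inner_eq_tsum]
  refine tsum_congr fun v => ?_
  by_cases hv : v ∈ S
  · simp [EllTwo.truncate_apply, hv]
  · simp [hp v hv]

theorem norm_inner_sq_le_of_support {S : Finset V} {p : EllTwo V} (hp : ∀ v, v ∉ S → p v = 0)
    (f : EllTwo V) : ‖⟪p, f⟫_ℂ‖ ^ 2 ≤ ‖p‖ ^ 2 * ∑ v ∈ S, ‖f v‖ ^ 2 := by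
  rw [← inner_truncate_of_support hp, ← EllTwo.norm_truncate_sq, ← mul_pow]
  gcongr
  exact norm_inner_le_norm _ _

/-- Cauchy-Schwarz for `p` and the characteristic function, whose squared norm is the cardinality.
-/
theorem one_le_theta {S : Finset V} {p : EllTwo V} (hp : ⟪p, charFun S⟫_ℂ ≠ 0) :
    1 ≤ theta S p := by
  rw [theta, one_le_div (by positivity), ← norm_charFun_sq, mul_comm, ← mul_pow]
  gcongr
  exact norm_inner_le_norm _ _

instance EllTwo.finiteDimensional [Finite V] : FiniteDimensional ℂ (EllTwo V) :=
  haveI := Fintype.ofFinite V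
  (lpPiLpₗᵢ (p := 2) (fun _ : V => ℂ) ℂ).symm.toLinearEquiv.finiteDimensional

end Truncation

/-! ## The Dirichlet form and the Poincaré inequality -/

namespace WeightedGraph

variable {V : Type*} (G : WeightedGraph V)

theorem summable_weight_mul_sq_fst (hG : G.BddDegree) (f : EllTwo V) :
    Summable fun x : V × V => G.w x.1 x.2 * ‖f x.1‖ ^ 2 := by
  obtain ⟨D, hD⟩ := hG
  have h0 : 0 ≤ fun x : V × V => G.w x.1 x.2 * ‖f x.1‖ ^ 2 := fun x =>
    mul_nonneg (G.nonneg _ _) (sq_nonneg _)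
  rw [summable_prod_of_nonneg h0]
  refine ⟨fun v => (G.summable v).mul_right (‖f v‖ ^ 2), ?_⟩
  have h1 : ∀ v, ∑' u, G.w v u * ‖f v‖ ^ 2 = G.degree v * ‖f v‖ ^ 2 := fun v => tsum_mul_right
  simp only [h1]
  exact Summable.of_nonneg_of_le (fun v => mul_nonneg (G.degree_nonneg v) (sq_nonneg _))
    (fun v => mul_le_mul_of_nonneg_right (hD v) (sq_nonneg _))
    ((EllTwo.hasSum_sq f).summable.mul_left D)

theorem summable_weight_mul_sq_snd (hG : G.BddDegree) (f : EllTwo V) :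
    Summable fun x : V × V => G.w x.1 x.2 * ‖f x.2‖ ^ 2 := by
  rw [← (Equiv.prodComm V V).summable_iff]
  refine (G.summable_weight_mul_sq_fst hG f).congr fun x => ?_
  simp [G.symm x.1 x.2]

/-- The Dirichlet form: `⟨L f, f⟩ = ½ ∑ w(u, v) |f(u) - f(v)|²`. -/
theorem hasSum_energy (hG : G.BddDegree) (f : EllTwo V) :
    HasSum (fun x : V × V => G.w x.1 x.2 * ‖f x.1 - f x.2‖ ^ 2 / 2)
      (⟪f, G.laplacian hG f⟫_ℂ).re := by
  -- The unsymmetrized summand of `⟨L f, f⟩`. Its summability over pairs permits averaging it with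
  -- its swap, which produces the square and the factor ½.
  set g : V × V → ℝ := fun x => ((G.w x.1 x.2 : ℂ) * (f x.1 - f x.2) *
    (starRingEnd ℂ) (f x.1)).re with hg
  have hgs : Summable g := by
    refine Summable.of_norm_bounded (((G.summable_weight_mul_sq_fst hG f).mul_left 2).add
      (G.summable_weight_mul_sq_snd hG f)) fun x => ?_
    refine (Complex.abs_re_le_norm _).trans ?_
    rw [norm_mul, norm_mul, Complex.norm_real, Real.norm_of_nonneg (G.nonneg _ _), RCLike.norm_conj]
    have h1 := norm_sub_le (f x.1) (f x.2)
    have h2 : ‖f x.1 - f x.2‖ * ‖f x.1‖ ≤ 2 * ‖f x.1‖ ^ 2 + ‖f x.2‖ ^ 2 := by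
      nlinarith [norm_nonneg (f x.1), norm_nonneg (f x.2), sq_nonneg (‖f x.1‖ - ‖f x.2‖)]
    nlinarith [mul_le_mul_of_nonneg_left h2 (G.nonneg x.1 x.2)]
  have h1 : HasSum g (⟪f, G.laplacian hG f⟫_ℂ).re := by
    have h2 := hgs.hasSum.prod_fiberwise
      (g := fun v => (⟪f v, G.laplacian hG f v⟫_ℂ).re) fun v => by
        have h3 := ((G.summable_lapFun f v).hasSum.mul_right (starRingEnd ℂ (f v)))
        exact Complex.hasSum_re h3
    have h4 := Complex.hasSum_re (lp.hasSum_inner f (G.laplacian hG f))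
    rw [h4.unique h2]
    exact hgs.hasSum
  have h5 := (h1.add ((Equiv.prodComm V V).hasSum_iff.2 h1)).div_const 2
  rw [add_self_div_two] at h5
  refine h5.congr_fun fun x => ?_
  simp only [hg, Function.comp_apply, Equiv.prodComm_apply, Prod.fst_swap, Prod.snd_swap,
    G.symm x.2 x.1]
  rw [← Complex.normSq_eq_norm_sq, Complex.normSq_apply]
  simp
  ring

theorem re_inner_laplacian_nonneg (hG : G.BddDegree) (f : EllTwo V) :
    0 ≤ (⟪f, G.laplacian hG f⟫_ℂ).re :=
  (G.hasSum_energy hG f).nonneg fun x =>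
    div_nonneg (mul_nonneg (G.nonneg _ _) (by positivity)) two_pos.le

/-- Zero energy forces equal values across every edge, and a walk carries this from `u` to `v`. -/
theorem eq_of_laplacian_eq_zero (hG : G.BddDegree) (hconn : G.graph.Connected) (f : EllTwo V)
    (hf : G.laplacian hG f = 0) (u v : V) : f u = f v := by
  have h1 := G.hasSum_energy hG f
  rw [hf, inner_zero_right, Complex.zero_re] at h1
  have h2 : ∀ a b, G.graph.Adj a b → f a = f b := by
    intro a b hab
    have h3 := (hasSum_zero_iff_of_nonneg fun x : V × V =>
      div_nonneg (mul_nonneg (G.nonneg x.1 x.2) (sq_nonneg ‖f x.1 - f x.2‖)) two_pos.le).1 h1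
    have h4 := congrFun h3 (a, b)
    have hab' : G.w a b ≠ 0 := hab
    simpa [hab', sub_eq_zero] using h4
  obtain ⟨p⟩ := hconn.preconnected u v
  induction p with
  | nil => rfl
  | cons hadj _ ih => exact (h2 _ _ hadj).trans ih

/-- On a finite connected graph, `λ ‖f‖² ≤ ⟨L f, f⟩` for `f` orthogonal to the constants, if `λ` is
a lower bound of the nonzero eigenvalues. -/
theorem mul_norm_sq_le_re_inner_laplacian [Fintype V] (hG : G.BddDegree)
    (hconn : G.graph.Connected) {l : ℝ}
    (hl : ∀ μ : ℝ, μ ≠ 0 → Module.End.HasEigenvalue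
      (G.laplacian hG : EllTwo V →ₗ[ℂ] EllTwo V) (μ : ℂ) → l ≤ μ)
    (f : EllTwo V) (hf : ∑ v, f v = 0) : l * ‖f‖ ^ 2 ≤ (⟪f, G.laplacian hG f⟫_ℂ).re := by
  have hT : (G.laplacian hG : EllTwo V →ₗ[ℂ] EllTwo V).IsSymmetric :=
    (G.isSelfAdjoint_laplacian hG).isSymmetric
  set b := hT.eigenvectorBasis rfl
  set μ := hT.eigenvalues rfl
  have hb : ∀ i, G.laplacian hG (b i) = (μ i : ℂ) • b i := fun i =>
    hT.apply_eigenvectorBasis rfl i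
  have h1 : (⟪f, G.laplacian hG f⟫_ℂ).re = ∑ i, μ i * ‖⟪b i, f⟫_ℂ‖ ^ 2 := by
    rw [← b.sum_inner_mul_inner, Complex.re_sum]
    refine Finset.sum_congr rfl fun i _ => ?_
    have h2 : ⟪b i, G.laplacian hG f⟫_ℂ = μ i * ⟪b i, f⟫_ℂ := by
      have h3 := hT (b i) f
      simp only [ContinuousLinearMap.coe_coe] at h3
      rw [← h3, hb, inner_smul_left, Complex.conj_ofReal]
    rw [h2, mul_left_comm, Complex.re_ofReal_mul, ← inner_conj_symm f (b i),
      ← Complex.normSq_eq_conj_mul_self, Complex.ofReal_re, Complex.normSq_eq_norm_sq]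
  rw [h1, ← b.sum_sq_norm_inner_right f, Finset.mul_sum]
  refine Finset.sum_le_sum fun i _ => ?_
  -- Eigenvectors for the eigenvalue 0 are constant, so the mean-zero `f` has no component along
  -- them.
  by_cases hi : μ i = 0
  · have h0 : G.laplacian hG (b i) = 0 := by rw [hb, hi]; simp
    have hconst := G.eq_of_laplacian_eq_zero hG hconn (b i) h0
    have : ⟪b i, f⟫_ℂ = 0 := by
      obtain ⟨v⟩ := hconn.nonempty
      rw [lp.inner_eq_tsum, tsum_fintype]
      have : ∀ u, ⟪b i u, f u⟫_ℂ = f u * starRingEnd ℂ (b i v) := fun u => by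
        rw [hconst u v]; rfl
      rw [Finset.sum_congr rfl fun u _ => this u, ← Finset.sum_mul, hf, zero_mul]
    simp [this]
  · have := hl (μ i) hi (hT.hasEigenvalue_eigenvalues rfl i)
    gcongr

/-- The energy `½ ∑ w(u, v) |f(u) - f(v)|²` of a function inside a finite set of vertices. -/
def energyOn (S : Finset V) (f : V → ℂ) : ℝ :=
  ∑ x ∈ S ×ˢ S, G.w x.1 x.2 * ‖f x.1 - f x.2‖ ^ 2 / 2

/-- The Poincaré inequality on a finite connected set of vertices. -/
theorem firstEigenvalue_mul_le_energyOn (S : Finset V) (hS : (G.induce S).graph.Connected)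
    (f : V → ℂ) (hf : ∑ v ∈ S, f v = 0) :
    G.firstEigenvalue S * ∑ v ∈ S, ‖f v‖ ^ 2 ≤ G.energyOn S f := by
  set F : EllTwo S := EllTwo.ofSummable (fun v : S => f v) Summable.of_finite
  have hF : ∀ v, F v = f v := fun v => rfl
  have hb := (G.induce S).bddDegree_of_finite
  have h1 := (G.induce S).mul_norm_sq_le_re_inner_laplacian hb hS (l := G.firstEigenvalue S)
    (fun μ hμ0 hμ => csInf_le ⟨0, fun ν hν => ?_⟩ ⟨hμ0, hμ⟩) F
    (by simpa [hF] using (Finset.sum_coe_sort S f).trans hf)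
  · rw [← (EllTwo.hasSum_sq F).tsum_eq, tsum_fintype,
      ← ((G.induce S).hasSum_energy hb F).tsum_eq, tsum_fintype, Fintype.sum_prod_type] at h1
    simp only [hF] at h1
    rw [Finset.sum_coe_sort S fun v => ‖f v‖ ^ 2] at h1
    refine h1.trans_eq ?_
    rw [energyOn, Finset.sum_product, ← Finset.sum_coe_sort S]
    refine Finset.sum_congr rfl fun v _ => ?_
    rw [← Finset.sum_coe_sort S]
    rfl
  -- Nonnegative eigenvalues make the set bounded below, as `csInf_le` requires.
  · refine eigenvalue_nonneg_of_nonneg hν.2 fun x => ?_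
    exact (G.induce S).re_inner_laplacian_nonneg hb x

end WeightedGraph

/-! ## Paley-Wiener spaces -/

section PaleyWiener

variable {H : Type*} [NormedAddCommGroup H] [InnerProductSpace ℂ H] [CompleteSpace H]

theorem paleyWiener_eq_ker (T : H →L[ℂ] H) (ω : ℝ) :
    paleyWiener T ω = (cfc (fun x : ℝ => Metric.infDist x (Set.Icc 0 ω)) T).ker :=
  Submodule.range_starProjection _

/-- The kernel of a bounded operator is closed. Completeness is what gives adjoints, and hence the
frame theory, on the subspace. -/
instance paleyWiener.completeSpace (T : H →L[ℂ] H) (ω : ℝ) : CompleteSpace (paleyWiener T ω) := by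
  rw [paleyWiener_eq_ker]
  infer_instance

theorem inner_pwProj (T : H →L[ℂ] H) (ω : ℝ) (g : H) (f : paleyWiener T ω) :
    ⟪pwProj T ω g, f⟫_ℂ = ⟪g, (f : H)⟫_ℂ := by
  have hf : (f : H) ∈ (cfc (fun x : ℝ => Metric.infDist x (Set.Icc 0 ω)) T).ker :=
    (paleyWiener_eq_ker T ω).le f.2
  change ⟪spectralProjection T (Set.Icc 0 ω) g, (f : H)⟫_ℂ = _
  rw [spectralProjection, Submodule.inner_starProjection_left_eq_right,
    Submodule.starProjection_eq_self_iff.2 hf]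

/-- Bernstein's inequality: `⟨T f, f⟩ ≤ ω ‖f‖²` on `PW_ω(T)`. -/
theorem re_inner_le_of_mem_paleyWiener {T : H →L[ℂ] H} (hT : IsSelfAdjoint T) {ω : ℝ} (hω : 0 ≤ ω)
    {f : H} (hf : f ∈ paleyWiener T ω) : (⟪f, T f⟫_ℂ).re ≤ ω * ‖f‖ ^ 2 := by
  rw [paleyWiener_eq_ker] at hf
  set d : ℝ → ℝ := fun x => Metric.infDist x (Set.Icc 0 ω) with hd
  have hdf : cfc d T f = 0 := hf
  have hdc : Continuous d := Metric.continuous_infDist_pt _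
  -- Since `x ≤ ω + d x`, also `T ≤ ω + d(T)`, and `d(T)` vanishes on `f`.
  have h1 : 0 ≤ cfc (fun x => (ω + d x) - x) T := by
    refine cfc_nonneg fun x _ => ?_
    have : x - ω ≤ d x := (Metric.le_infDist (Set.nonempty_Icc.2 hω)).2 fun {y} hy => by
      rw [Real.dist_eq]
      exact (by linarith [hy.2] : x - ω ≤ x - y).trans (le_abs_self _)
    linarith
  rw [cfc_sub (fun x => ω + d x) (fun x => x) T (by fun_prop) (by fun_prop),
    cfc_add T (fun _ => ω) d (by fun_prop) (by fun_prop), cfc_const ω T, cfc_id' ℝ T] at h1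
  have h2 := ((ContinuousLinearMap.nonneg_iff_isPositive _).1 h1).re_inner_nonneg_right f
  have h3 : (algebraMap ℝ (H →L[ℂ] H) ω + cfc d T - T) f = (ω : ℂ) • f - T f := by
    simp [hdf, Algebra.algebraMap_eq_smul_one]
  have h4 : (⟪f, f⟫_ℂ).re = ‖f‖ ^ 2 := (norm_sq_eq_re_inner (𝕜 := ℂ) f).symm
  rw [h3, inner_sub_right, inner_smul_right] at h2
  simp only [RCLike.re_to_complex, Complex.sub_re, Complex.re_ofReal_mul, h4] at h2
  linarith

end PaleyWiener

/-! ## Covers by finite sets without common edges -/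

namespace WeightedGraph

variable {V J : Type*} (G : WeightedGraph V)

theorem sum_filter_weight_ne_zero (s : Finset (V × V)) (a : V × V → ℝ) :
    ∑ x ∈ s with G.w x.1 x.2 ≠ 0, G.w x.1 x.2 * a x = ∑ x ∈ s, G.w x.1 x.2 * a x :=
  Finset.sum_filter_of_ne fun x _ h h0 => h (by rw [h0, zero_mul])

section Cover

variable {S : J → Finset V}
  (hedge : ∀ j k, j ≠ k → ∀ u v, u ∈ S j → v ∈ S j → u ∈ S k → v ∈ S k → ¬ G.graph.Adj u v)
include hedge

/-- For sets without common edges, a weighted sum over the edges inside the sets is a sum over a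
finite set of pairs of vertices. -/
theorem exists_finset_sum_eq (t : Finset J) : ∃ P : Finset (V × V), ∀ a : V × V → ℝ,
    ∑ j ∈ t, ∑ x ∈ S j ×ˢ S j, G.w x.1 x.2 * a x = ∑ x ∈ P, G.w x.1 x.2 * a x := by
  classical
  -- The squares `S j ×ˢ S j` may overlap; they become disjoint once pairs of weight zero are
  -- dropped.
  refine ⟨t.biUnion fun j => {x ∈ S j ×ˢ S j | G.w x.1 x.2 ≠ 0}, fun a => ?_⟩
  rw [Finset.sum_biUnion]
  · exact Finset.sum_congr rfl fun j _ => (G.sum_filter_weight_ne_zero _ _).symm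
  · intro j _ k _ hjk
    refine Finset.disjoint_left.2 fun x hx hx' => ?_
    simp only [Finset.mem_filter, Finset.mem_product] at hx hx'
    exact hedge j k hjk _ _ hx.1.1 hx.1.2 hx'.1.1 hx'.1.2 hx.2

theorem sum_energyOn_le (hG : G.BddDegree) (t : Finset J) (f : EllTwo V) :
    ∑ j ∈ t, G.energyOn (S j) f ≤ (⟪f, G.laplacian hG f⟫_ℂ).re := by
  obtain ⟨P, hP⟩ := G.exists_finset_sum_eq hedge t
  simp only [energyOn, mul_div_assoc]
  rw [hP fun x => ‖f x.1 - f x.2‖ ^ 2 / 2]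
  simp only [← mul_div_assoc]
  exact sum_le_hasSum P (fun x _ =>
    div_nonneg (mul_nonneg (G.nonneg _ _) (by positivity)) two_pos.le) (G.hasSum_energy hG f)

theorem sum_sum_weight_le_degree (t : Finset J) (v : V) (ht : ∀ j ∈ t, v ∈ S j) :
    ∑ j ∈ t, ∑ u ∈ S j, G.w v u ≤ G.degree v := by
  classical
  have h1 : ∀ j, ∑ u ∈ S j, G.w v u = ∑ u ∈ S j with G.w v u ≠ 0, G.w v u := fun j =>
    (Finset.sum_filter_ne_zero _).symm
  simp only [h1]
  rw [← Finset.sum_biUnion]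
  · exact (G.summable v).sum_le_tsum _ fun u _ => G.nonneg v u
  · intro j hj k hk hjk
    refine Finset.disjoint_left.2 fun u hu hu' => ?_
    simp only [Finset.mem_filter] at hu hu'
    exact hedge j k hjk v u (ht j hj) hu.1 (ht k hk) hu'.1 hu.2

end Cover

/-- The first nonzero eigenvalue is at most four times the degree of any vertex. -/
theorem firstEigenvalue_le_sum_weight {S : Finset V} (hS : (G.induce S).graph.Connected)
    (hcard : 1 < S.card) (hpos : 0 ≤ G.firstEigenvalue S) {v : V} (hv : v ∈ S) :
    G.firstEigenvalue S ≤ 4 * ∑ u ∈ S, G.w v u := by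
  classical
  -- The test function is the point mass at `v` minus its mean over `S`. As `S` has at least two
  -- points, its value at `v` is at least 1/2, whence the factor 4.
  set δ : V → ℂ := fun u => if u = v then 1 else 0 with hδ
  have hn : (2 : ℝ) ≤ S.card := by exact_mod_cast hcard
  have h1 := G.firstEigenvalue_mul_le_energyOn S hS (fun u => δ u - 1 / S.card) (by
    have : (S.card : ℂ) ≠ 0 := by exact_mod_cast (by omega : S.card ≠ 0)
    simp [hδ, Finset.sum_sub_distrib, hv, this])
  have h2 : 1 / 4 ≤ ∑ u ∈ S, ‖δ u - 1 / (S.card : ℂ)‖ ^ 2 := by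
    refine le_trans ?_ (Finset.single_le_sum (fun u _ => by positivity) hv)
    have h3 : δ v - 1 / (S.card : ℂ) = ((1 - 1 / S.card : ℝ) : ℂ) := by simp [hδ]
    have h4 : (1 : ℝ) / S.card ≤ 1 / 2 := by gcongr
    rw [h3, Complex.norm_real, Real.norm_of_nonneg (by linarith)]
    nlinarith
  have h5 : G.energyOn S (fun u => δ u - 1 / S.card) ≤ ∑ u ∈ S, G.w v u := by
    have h6 : ∀ a b, G.w a b * ‖(δ a - 1 / (S.card : ℂ)) - (δ b - 1 / (S.card : ℂ))‖ ^ 2 / 2 ≤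
        (if a = v then G.w a b / 2 else 0) + (if b = v then G.w a b / 2 else 0) := by
      intro a b
      have := G.nonneg a b
      rw [sub_sub_sub_cancel_right]
      by_cases ha : a = v <;> by_cases hb : b = v <;> simp [hδ, ha, hb]
      exact G.nonneg v v
    rw [energyOn, Finset.sum_product]
    refine (Finset.sum_le_sum fun a _ => Finset.sum_le_sum fun b _ => h6 a b).trans ?_
    simp only [Finset.sum_add_distrib]
    rw [Finset.sum_comm (f := fun a b => if a = v then G.w a b / 2 else 0)]
    simp only [Finset.sum_ite_eq', hv, if_true]
    rw [← Finset.sum_add_distrib]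
    exact le_of_eq (Finset.sum_congr rfl fun u _ => by rw [G.symm u v]; ring)
  nlinarith

/-- The multiplicity of the cover is bounded. -/
theorem exists_encard_le (hG : G.BddDegree) {S : J → Finset V}
    (hedge : ∀ j k, j ≠ k → ∀ u v, u ∈ S j → v ∈ S j → u ∈ S k → v ∈ S k → ¬ G.graph.Adj u v)
    (hSconn : ∀ j, (G.induce (S j)).graph.Connected) (hScard : ∀ j, 1 < (S j).card)
    {l : ℝ} (hl : 0 < l) (hlS : ∀ j, l ≤ G.firstEigenvalue (S j)) :
    ∃ N : ℕ, ∀ v, {j | v ∈ S j}.encard ≤ N := by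
  obtain ⟨D, hD⟩ := hG
  obtain ⟨N, hN⟩ := exists_nat_gt (4 * D / l)
  refine ⟨N, fun v => ?_⟩
  by_contra! hlt
  -- Exactly `N` sets through `v` already contradict `N > 4 D / l`, since `N l` is at most four
  -- times the degree.
  obtain ⟨t, ht, htN⟩ := Set.exists_subset_encard_eq hlt.le
  have htf : t.Finite := Set.finite_of_encard_eq_coe htN
  lift t to Finset J using htf
  rw [Set.encard_coe_eq_coe_finsetCard, Nat.cast_inj] at htN
  have h1 := G.sum_sum_weight_le_degree hedge t v fun j hj => ht hj
  have h2 : ∑ j ∈ t, l ≤ ∑ j ∈ t, 4 * ∑ u ∈ S j, G.w v u := Finset.sum_le_sum fun j hj =>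
    (hlS j).trans (G.firstEigenvalue_le_sum_weight (hSconn j) (hScard j)
      (hl.le.trans (hlS j)) (ht hj))
  rw [Finset.sum_const, nsmul_eq_mul, htN, ← Finset.mul_sum] at h2
  rw [div_lt_iff₀ hl] at hN
  linarith [hD v]

theorem sum_sum_norm_sq_le {S : J → Finset V} {N : ℕ} (hN : ∀ v, {j | v ∈ S j}.encard ≤ N)
    (t : Finset J) (f : EllTwo V) : ∑ j ∈ t, ∑ v ∈ S j, ‖f v‖ ^ 2 ≤ N * ‖f‖ ^ 2 := by
  classical
  have h1 : ∑ j ∈ t, ∑ v ∈ S j, ‖f v‖ ^ 2 =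
      ∑ v ∈ t.biUnion S, ∑ j ∈ t with v ∈ S j, ‖f v‖ ^ 2 := by
    refine Finset.sum_comm' fun j v => ?_
    simp only [Finset.mem_filter, Finset.mem_biUnion]
    exact ⟨fun h => ⟨h, j, h⟩, fun h => h.1⟩
  have h2 : ∀ (v : V) (t' : Finset J), (∀ j ∈ t', v ∈ S j) → (t'.card : ℝ) ≤ N := by
    intro v t' ht'
    have h3 : (t' : Set J).encard ≤ N := (Set.encard_mono fun j hj => ht' j hj).trans (hN v)
    rw [Set.encard_coe_eq_coe_finsetCard] at h3
    exact_mod_cast h3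
  rw [h1]
  calc _ ≤ ∑ v ∈ t.biUnion S, N * ‖f v‖ ^ 2 := Finset.sum_le_sum fun v _ => by
        rw [Finset.sum_const, nsmul_eq_mul]
        exact mul_le_mul_of_nonneg_right (h2 v _ fun j hj => (Finset.mem_filter.1 hj).2)
          (sq_nonneg _)
    _ ≤ _ := by
        rw [← Finset.mul_sum]
        gcongr
        exact sum_sq_le f _

/-- The Poincaré-type inequality on one set of the cover. -/
theorem sum_norm_sq_le_energyOn {S : Finset V} (hS : (G.induce S).graph.Connected)
    (hcard : S.card ≠ 0) {p : EllTwo V} (hsupp : ∀ v, v ∉ S → p v = 0)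
    (hp : ⟪p, charFun S⟫_ℂ ≠ 0) {Θ Λ ε c : ℝ} (hΘ : theta S p ≤ Θ) (hΛ : 0 < Λ)
    (hΛS : Λ ≤ G.firstEigenvalue S) (hε : 0 < ε)
    (hc : (S.card : ℝ) ^ 2 / ‖⟪p, charFun S⟫_ℂ‖ ^ 2 ≤ c) (f : EllTwo V) :
    ∑ v ∈ S, ‖f v‖ ^ 2 ≤ (1 + ε) * (Θ / Λ) * G.energyOn S f +
      (1 + ε) / ε * (c * ‖⟪p, f⟫_ℂ‖ ^ 2) := by
  set m : ℂ := (∑ v ∈ S, f v) / S.card with hm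
  have hcard' : (S.card : ℂ) ≠ 0 := by exact_mod_cast hcard
  have hmean : ∑ v ∈ S, (f v - m) = 0 := by
    rw [Finset.sum_sub_distrib, Finset.sum_const, nsmul_eq_mul, hm, mul_div_cancel₀ _ hcard',
      sub_self]
  have hdecomp : EllTwo.truncate S f = EllTwo.truncate S (fun v => f v - m) + m • charFun S := by
    classical
    ext v
    rw [charFun_eq_truncate]
    change EllTwo.truncate S f v =
      EllTwo.truncate S (fun v => f v - m) v + m * EllTwo.truncate S 1 v
    by_cases hv : v ∈ S <;> simp [EllTwo.truncate_apply, hv]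
  have h1 := norm_sq_le_of_inner_ne_zero p (charFun S) (EllTwo.truncate S fun v => f v - m) m
    (by rw [inner_charFun_truncate, hmean]) hp hε
  rw [← hdecomp, EllTwo.norm_truncate_sq, EllTwo.norm_truncate_sq, inner_truncate_of_support hsupp,
    norm_charFun_sq] at h1
  have h2 := G.firstEigenvalue_mul_le_energyOn S hS _ hmean
  have h3 : G.energyOn S (fun v => f v - m) = G.energyOn S f := by
    simp only [energyOn, sub_sub_sub_cancel_right]
  rw [h3] at h2
  have hΘ0 : 0 ≤ Θ := (zero_le_one.trans (one_le_theta hp)).trans hΘ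
  have h4 : ∑ v ∈ S, ‖f v - m‖ ^ 2 ≤ G.energyOn S f / Λ := by
    rw [le_div_iff₀' hΛ]
    exact (mul_le_mul_of_nonneg_right hΛS (Finset.sum_nonneg fun v _ => by positivity)).trans h2
  -- One power of the cardinality suffices here; the square in `hc` is larger.
  have h5 : (S.card : ℝ) / ‖⟪p, charFun S⟫_ℂ‖ ^ 2 ≤ c := by
    refine le_trans ?_ hc
    gcongr
    have : (1 : ℝ) ≤ S.card := by exact_mod_cast Nat.one_le_iff_ne_zero.2 hcard
    nlinarith
  refine h1.trans (add_le_add ?_ ?_)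
  · calc _ ≤ (1 + ε) * Θ * (G.energyOn S f / Λ) := by
          gcongr
          exact hΘ
      _ = _ := by ring
  · gcongr

/-! ### Global upper and lower estimates for the samples -/

section Bounds

variable {S : J → Finset V} {ψ : J → EllTwo V} (hsupp : ∀ j, ∀ v, v ∉ S j → ψ j v = 0)
include hsupp

theorem sum_norm_inner_sq_le {C : ℝ} (hC0 : 0 ≤ C) (hC : ∀ j, ‖ψ j‖ ^ 2 ≤ C) {N : ℕ}
    (hN : ∀ v, {j | v ∈ S j}.encard ≤ N) (f : EllTwo V) (t : Finset J) :
    ∑ j ∈ t, ‖⟪ψ j, f⟫_ℂ‖ ^ 2 ≤ C * N * ‖f‖ ^ 2 :=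
  calc _ ≤ ∑ j ∈ t, C * ∑ v ∈ S j, ‖f v‖ ^ 2 := Finset.sum_le_sum fun j _ =>
        (norm_inner_sq_le_of_support (hsupp j) f).trans
          (mul_le_mul_of_nonneg_right (hC j) (Finset.sum_nonneg fun v _ => by positivity))
    _ ≤ C * (N * ‖f‖ ^ 2) := by
        rw [← Finset.mul_sum]
        exact mul_le_mul_of_nonneg_left (sum_sum_norm_sq_le hN t f) hC0
    _ = _ := by ring

/-- A Plancherel-Polya inequality: the norm of `f` is controlled by its energy and its samples. -/
theorem norm_sq_le_energy_add_tsum (hG : G.BddDegree) (hcover : ∀ v, ∃ j, v ∈ S j)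
    (hedge : ∀ j k, j ≠ k → ∀ u v, u ∈ S j → v ∈ S j → u ∈ S k → v ∈ S k → ¬ G.graph.Adj u v)
    (hSconn : ∀ j, (G.induce (S j)).graph.Connected) (hScard : ∀ j, (S j).card ≠ 0)
    (hΨ : ∀ j, ⟪ψ j, charFun (S j)⟫_ℂ ≠ 0) {Θ Λ ε c : ℝ} (hΘ0 : 0 ≤ Θ)
    (hΘ : ∀ j, theta (S j) (ψ j) ≤ Θ) (hΛ : 0 < Λ) (hΛS : ∀ j, Λ ≤ G.firstEigenvalue (S j))
    (hε : 0 < ε) (hc0 : 0 ≤ c)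
    (hc : ∀ j, ((S j).card : ℝ) ^ 2 / ‖⟪ψ j, charFun (S j)⟫_ℂ‖ ^ 2 ≤ c) (f : EllTwo V)
    (hf : Summable fun j => ‖⟪ψ j, f⟫_ℂ‖ ^ 2) :
    ‖f‖ ^ 2 ≤ (1 + ε) * (Θ / Λ) * (⟪f, G.laplacian hG f⟫_ℂ).re +
      (1 + ε) / ε * (c * ∑' j, ‖⟪ψ j, f⟫_ℂ‖ ^ 2) := by
  classical
  choose i hi using hcover
  refine hasSum_le_of_sum_le (EllTwo.hasSum_sq f) fun s => ?_
  -- Each vertex of `s` is assigned to one chosen set containing it, so finitely many sets cover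
  -- `s`.
  set t := s.image i
  have h1 : ∑ v ∈ s, ‖f v‖ ^ 2 ≤ ∑ j ∈ t, ∑ v ∈ S j, ‖f v‖ ^ 2 := by
    rw [← Finset.sum_fiberwise_of_maps_to (g := i) (t := t)
      fun v hv => Finset.mem_image_of_mem i hv]
    refine Finset.sum_le_sum fun j _ => Finset.sum_le_sum_of_subset_of_nonneg (fun v hv => ?_)
      fun v _ _ => by positivity
    rw [← (Finset.mem_filter.1 hv).2]
    exact hi v
  have h2 : ∑ j ∈ t, ∑ v ∈ S j, ‖f v‖ ^ 2 ≤ ∑ j ∈ t, ((1 + ε) * (Θ / Λ) * G.energyOn (S j) f +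
      (1 + ε) / ε * (c * ‖⟪ψ j, f⟫_ℂ‖ ^ 2)) := Finset.sum_le_sum fun j _ =>
    G.sum_norm_sq_le_energyOn (hSconn j) (hScard j) (hsupp j) (hΨ j) (hΘ j) hΛ (hΛS j) hε (hc j) f
  refine h1.trans (h2.trans ?_)
  rw [Finset.sum_add_distrib, ← Finset.mul_sum, ← Finset.mul_sum, ← Finset.mul_sum]
  gcongr
  · exact G.sum_energyOn_le hedge hG t f
  · exact hf.sum_le_tsum t fun j _ => by positivity

end Bounds

end WeightedGraph

end

/-! ### The sampling theorem -/

theorem theorem5 {V J : Type*} [Countable V] (G : WeightedGraph V) (hG : G.BddDegree)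
    (hconn : G.graph.Connected)
    -- the cover by finite connected sets with more than one vertex, sharing no edges
    (S : J → Finset V) (hcover : ∀ v, ∃ j, v ∈ S j)
    (hedge : ∀ j k, j ≠ k → ∀ u v, u ∈ S j → v ∈ S j → u ∈ S k → v ∈ S k → ¬ G.graph.Adj u v)
    (hSconn : ∀ j, (G.induce (S j)).graph.Connected) (hScard : ∀ j, 1 < (S j).card)
    -- the functionals `Ψ_j(f) = ⟨f, ψ_j⟩`, with `ψ_j` supported in `S_j` and `Ψ_j(χ_j) ≠ 0`
    (ψ : J → EllTwo V) (hsupp : ∀ j, ∀ v, v ∉ S j → ψ j v = 0)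
    (hΨ : ∀ j, ⟪ψ j, charFun (S j)⟫_ℂ ≠ 0)
    -- `Θ = sup θ_j < ∞` and `Λ = inf λ_{1,j} > 0`
    (Θ Λ : ℝ) (hΘ : IsLUB (Set.range fun j => theta (S j) (ψ j)) Θ)
    (hΛ : IsGLB (Set.range fun j => G.firstEigenvalue (S j)) Λ) (hΛpos : 0 < Λ)
    (ε ω γ : ℝ) (hε : 0 < ε) (hω : 0 < ω) (hωlt : ω < Λ / ((1 + ε) * Θ))
    (hγ : γ = (1 + ε) * (Θ / Λ) * ω)
    (c C : ℝ) (hc : ∀ j, ((S j).card : ℝ) ^ 2 / ‖⟪ψ j, charFun (S j)⟫_ℂ‖ ^ 2 ≤ c)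
    (hC : ∀ j, ‖ψ j‖ ^ 2 ≤ C)
    -- the orthogonal projections of the `ψ_j` to `PW_ω(L)`
    (ξ : J → paleyWiener (G.laplacian hG) ω)
    (hξ : ∀ j, ξ j = pwProj (G.laplacian hG) ω (ψ j)) :
    -- the functionals `Ψ_j` form a frame of `PW_ω(L)`, with explicit frame bounds
    (∀ (f : paleyWiener (G.laplacian hG) ω) (j : J), ⟪ξ j, f⟫_ℂ = ⟪ψ j, (f : EllTwo V)⟫_ℂ) ∧
    (∃ N : ℕ, ∀ v, {j | v ∈ S j}.encard ≤ N) ∧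
    (∀ N : ℕ, (∀ v, {j | v ∈ S j}.encard ≤ N) →
      (1 - γ) * ε / ((1 + ε) * c) ≤ C * N ∧
      IsFrame ξ ((1 - γ) * ε / ((1 + ε) * c)) (C * N)) ∧
    -- uniqueness
    (∀ f g : paleyWiener (G.laplacian hG) ω,
      (∀ j, ⟪ψ j, (f : EllTwo V)⟫_ℂ = ⟪ψ j, (g : EllTwo V)⟫_ℂ) → f = g) ∧
    -- stable reconstruction by a dual frame
    (∃ Ω : J → paleyWiener (G.laplacian hG) ω,
      (∀ f : paleyWiener (G.laplacian hG) ω,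
        HasSum (fun j => ⟪ψ j, (f : EllTwo V)⟫_ℂ • Ω j) f) ∧
      ∀ A B : ℝ, IsFrame ξ A B →
        IsFrame Ω B⁻¹ A⁻¹ ∧
        ∀ (f : paleyWiener (G.laplacian hG) ω) (e : J → ℂ), Summable (fun j => ‖e j‖ ^ 2) →
          Summable (fun j => (⟪ψ j, (f : EllTwo V)⟫_ℂ + e j) • Ω j) ∧
          ‖f - ∑' j, (⟪ψ j, (f : EllTwo V)⟫_ℂ + e j) • Ω j‖ ≤
            1 / √A * √(∑' j, ‖e j‖ ^ 2)) ∧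
    -- stable reconstruction by the frame algorithm, with geometric convergence
    (∀ A B ρ η : ℝ, IsFrame ξ A B → A ≤ B → 0 < ρ → ρ < 2 / B →
      η = max |1 - ρ * A| |1 - ρ * B| →
        η < 1 ∧
        (∀ e : J → ℂ, Summable (fun j => ‖e j‖ ^ 2) → Summable fun j => e j • ξ j) ∧
        ∀ f : paleyWiener (G.laplacian hG) ω,
          (∀ n, ‖f - frameAlgorithm ξ ρ (fun j => ⟪ψ j, (f : EllTwo V)⟫_ℂ) n‖ ≤ η ^ n * ‖f‖) ∧
          Filter.Tendsto (frameAlgorithm ξ ρ fun j => ⟪ψ j, (f : EllTwo V)⟫_ℂ)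
            Filter.atTop (𝓝 f) ∧
          ∀ e : J → ℂ, Summable (fun j => ‖e j‖ ^ 2) → ∀ n,
            ‖f - frameAlgorithm ξ ρ (fun j => ⟪ψ j, (f : EllTwo V)⟫_ℂ + e j) n‖ ≤
              η ^ n * ‖f‖ + 2 / √A * √(∑' j, ‖e j‖ ^ 2)) := by
  have hTsa := G.isSelfAdjoint_laplacian hG
  have hinner : ∀ (f : paleyWiener (G.laplacian hG) ω) (j : J),
      ⟪ξ j, f⟫_ℂ = ⟪ψ j, (f : EllTwo V)⟫_ℂ := fun f j => by rw [hξ, inner_pwProj]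
  have hΘj : ∀ j, theta (S j) (ψ j) ≤ Θ := fun j => hΘ.1 ⟨j, rfl⟩
  have hΛj : ∀ j, Λ ≤ G.firstEigenvalue (S j) := fun j => hΛ.1 ⟨j, rfl⟩
  -- A vertex gives an index `j₀`, which supplies the positivity of `Θ` and `c` and the comparison
  -- of the frame bounds.
  obtain ⟨v₀⟩ := hconn.nonempty
  obtain ⟨j₀, hj₀⟩ := hcover v₀
  have hΘpos : 0 < Θ := (zero_lt_one.trans_le (one_le_theta (hΨ j₀))).trans_le (hΘj j₀)
  have hcpos : 0 < c := by
    refine lt_of_lt_of_le ?_ (hc j₀)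
    have h1 : (0 : ℝ) < (S j₀).card := by exact_mod_cast (zero_lt_one.trans (hScard j₀))
    have h2 := norm_pos_iff.2 (hΨ j₀)
    positivity
  have hC0 : 0 ≤ C := (sq_nonneg _).trans (hC j₀)
  have hγ0 : 0 < γ := by rw [hγ]; positivity
  have hγ1 : γ < 1 := by
    rw [lt_div_iff₀ (by positivity)] at hωlt
    rw [hγ, mul_div_assoc', div_mul_eq_mul_div, div_lt_one hΛpos]
    linarith
  have hA0 : 0 < (1 - γ) * ε / ((1 + ε) * c) := by
    have := sub_pos.2 hγ1
    positivity
  obtain ⟨N₀, hN₀⟩ := G.exists_encard_le hG hedge hSconn hScard hΛpos hΛj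
  have hbound : ∀ N : ℕ, (∀ v, {j | v ∈ S j}.encard ≤ N) →
      (1 - γ) * ε / ((1 + ε) * c) ≤ C * N := by
    intro N hN
    have hN1 : (1 : ℝ) ≤ N := by
      have h1 : (1 : ℕ∞) ≤ N := (Set.one_le_encard_iff_nonempty.2 ⟨j₀, hj₀⟩).trans (hN v₀)
      exact_mod_cast h1
    -- The number `|S| θ` is at least 1 and factors as `‖ψ‖²` times the quotient bounded by `c`.
    have hcC : 1 ≤ C * c := by
      have h1 : (1 : ℝ) ≤ (S j₀).card := by exact_mod_cast (hScard j₀).le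
      have h2 : 1 * 1 ≤ ((S j₀).card : ℝ) * theta (S j₀) (ψ j₀) := by
        gcongr
        exact one_le_theta (hΨ j₀)
      calc (1 : ℝ) ≤ ((S j₀).card : ℝ) * theta (S j₀) (ψ j₀) := by linarith
        _ = ‖ψ j₀‖ ^ 2 * ((S j₀).card ^ 2 / ‖⟪ψ j₀, charFun (S j₀)⟫_ℂ‖ ^ 2) := by
            rw [theta]; ring
        _ ≤ C * c := by
            gcongr
            · exact hC j₀
            · exact hc j₀
    rw [div_le_iff₀ (by positivity)]
    calc (1 - γ) * ε ≤ (1 + ε) * 1 := by nlinarith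
      _ ≤ (1 + ε) * ((C * c) * N) := by
          gcongr
          nlinarith
      _ = _ := by ring
  have hframe : ∀ N : ℕ, (∀ v, {j | v ∈ S j}.encard ≤ N) →
      IsFrame ξ ((1 - γ) * ε / ((1 + ε) * c)) (C * N) := by
    intro N hN
    have hup : ∀ (f : paleyWiener (G.laplacian hG) ω) (t : Finset J),
        ∑ j ∈ t, ‖⟪ξ j, f⟫_ℂ‖ ^ 2 ≤ C * N * ‖f‖ ^ 2 := fun f t => by
      simp only [hinner]
      exact WeightedGraph.sum_norm_inner_sq_le hsupp hC0 hC hN f t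
    have hsum : ∀ f : paleyWiener (G.laplacian hG) ω, Summable fun j => ‖⟪ξ j, f⟫_ℂ‖ ^ 2 :=
      fun f => summable_of_sum_le (fun j => by positivity) (hup f)
    refine ⟨hA0, hA0.trans_le (hbound N hN), hsum, fun f => ?_,
      fun f => (hsum f).tsum_le_of_sum_le (hup f)⟩
    have hs := hsum f
    simp only [hinner] at hs ⊢
    have h1 := G.norm_sq_le_energy_add_tsum hsupp hG hcover hedge hSconn
      (fun j => (zero_lt_one.trans (hScard j)).ne') hΨ hΘpos.le hΘj hΛpos hΛj hε hcpos.le hc f hs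
    have h2 := re_inner_le_of_mem_paleyWiener hTsa hω.le f.2
    have h3 : (1 + ε) * (Θ / Λ) * (⟪(f : EllTwo V), G.laplacian hG f⟫_ℂ).re ≤
        γ * ‖(f : EllTwo V)‖ ^ 2 := by
      rw [hγ, mul_assoc _ ω]
      gcongr
    rw [div_mul_eq_mul_div, div_le_iff₀ (by positivity), Submodule.coe_norm]
    -- The energy term is at most `γ ‖f‖²` and is absorbed into the left side.
    have h4 : (1 - γ) * ‖(f : EllTwo V)‖ ^ 2 ≤
        (1 + ε) / ε * (c * ∑' j, ‖⟪ψ j, (f : EllTwo V)⟫_ℂ‖ ^ 2) := by linarith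
    rw [div_mul_eq_mul_div, le_div_iff₀ hε] at h4
    linarith
  -- Any one choice of bounds serves to define the dual frame; `isFrame_dual` then transfers all
  -- others.
  have hF := hframe N₀ hN₀
  have hsamples : ∀ f : paleyWiener (G.laplacian hG) ω,
      (fun j => ⟪ψ j, (f : EllTwo V)⟫_ℂ) = fun j => ⟪ξ j, f⟫_ℂ := fun f =>
    funext fun j => (hinner f j).symm
  refine ⟨hinner, ⟨N₀, hN₀⟩, fun N hN => ⟨hbound N hN, hframe N hN⟩, fun f g hfg => ?_,
    ⟨hF.dual, fun f => ?_, fun A B hAB => ⟨hF.isFrame_dual hAB, fun f e he => ?_⟩⟩, ?_⟩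
  · have h1 : hF.analysis f = hF.analysis g := by
      ext j
      rw [hF.analysis_apply, hF.analysis_apply, hinner, hinner, hfg]
    rw [← hF.inverse_operator f, ← hF.inverse_operator g, hF.operator_apply, hF.operator_apply, h1]
  · simp only [← hinner]
    exact hF.hasSum_inner_smul_dual f
  · have h1 : HasSum (fun j => (⟪ψ j, (f : EllTwo V)⟫_ℂ + e j) • hF.dual j)
        (f + hF.inverse (hF.synthesis (EllTwo.ofSummable e he))) := by
      simp only [← hinner, add_smul]
      exact (hF.hasSum_inner_smul_dual f).add (hF.hasSum_dual_smul (EllTwo.ofSummable e he))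
    refine ⟨h1.summable, ?_⟩
    rw [h1.tsum_eq, sub_add_cancel_left, norm_neg, ← EllTwo.norm_ofSummable e he]
    exact hF.norm_inverse_synthesis_le hAB _
  · rintro A B ρ η hAB hle hρ hρB rfl
    have hη := hAB.abs_max_lt_one hle hρ hρB
    refine ⟨hη, fun e he => (hAB.hasSum_synthesis (EllTwo.ofSummable e he)).summable, fun f => ?_⟩
    have h1 := hAB.norm_sub_frameAlgorithm_le hρ f
    refine ⟨fun n => by rw [hsamples]; exact h1 n, ?_, fun e he n => ?_⟩
    · rw [hsamples, tendsto_iff_norm_sub_tendsto_zero]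
      refine squeeze_zero (fun n => norm_nonneg _) (fun n => (norm_sub_rev _ _).trans_le (h1 n)) ?_
      simpa using (tendsto_pow_atTop_nhds_zero_of_lt_one
        (le_max_of_le_left (abs_nonneg _)) hη).mul_const ‖f‖
    · simp only [← hinner]
      rw [← EllTwo.norm_ofSummable e he]
      exact hAB.norm_sub_frameAlgorithm_add_le hle hρ hρB f (EllTwo.ofSummable e he) n
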